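/- Let $n,N\ge 1$ and let $S_1,\dots,S_N$ be maps $S_i(x)=A_ix+b_i$ on $\mathbb{R}^n$ with $A_i\in \mathrm{GL}(n,\mathbb{R})$, $b_i\in\mathbb{R}^n$, each a strict contraction for the Euclidean norm: $|S_i(x)-S_i(y)|\le c_i|x-y|$ for some $c_i\in(0,1)$. Let $C\subset\mathbb{R}^n$ be non-empty and compact, and let $F_C$ be the inhomogeneous attractor with condensation set $C$, that is, the unique non-empty compact set with $F_C=\bigcup_{i=1}^N S_i(F_C)\cup C$. Notation. For a non-empty bounded set $E\subset\mathbb{R}^n$ let $N_\delta(E)$ be the least number of hypercubes of sidelength $\delta$ that cover $E$, and let $$\overline{\dim}_{\mathrm B}E=\limsup_{\delta\to0}\frac{\log N_\delta(E)}{-\log\delta},\qquad \underline{\dim}_{\mathrm B}E=\liminf_{\delta\to0}\frac{\log N_\delta(E)}{-\log\delta}.$$ For a finite word $\mathbf i=(i_1,\dots,i_k)$ over $\{1,\dots,N\}$ put $S_{\mathbf i}=S_{i_1}\circ\dots\circ S_{i_k}$ (the identity for the empty word) and $\mathbf i_-=(i_1,\dots,i_{k-1})$. For an invertible affine map $S$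 let $\alpha_1(S)\ge\dots\ge\alpha_n(S)>0$ be the singular values of its linear part $A$; let $\phi^0(S)=1$, let $\phi^t(S)=\alpha_1(S)\cdots\alpha_{m-1}(S)\,\alpha_m(S)^{t-m+1}$ if $0<t\le n$ and $m$ is the integer with $m-1<t\le m$, and let $\phi^t(S)=|\det A|^{t/n}$ if $t>n$. For $k\ge1$ let $s_k\ge0$ be the solution of $\sum_{\mathbf i\in\{1,\dots,N\}^k}\phi^{s_k}(S_{\mathbf i})=1$. The affinity dimension of the system is $s=\lim_{k\to\infty}s_k$; this limit exists. For $\delta\in(0,1]$ let $\mathcal I_n(\delta)$ be the set of non-empty finite words $\mathbf i$ with $\alpha_n(S_{\mathbf i})<\delta\le\alpha_n(S_{\mathbf i_-})$. Assume the condensation open set condition: there is an open set $U\subseteq\mathbb{R}^n$ with $C\subseteq U\setminus\bigcup_{i=1}^N\overline{S_i(U)}$, with $S_i(U)\subseteq U$ for all $i$, and with $S_i(U)\cap S_j(U)=\emptyset$ whenever $i\ne j$. Let $X$ be a closed ball of positive radius with $C\subseteq X$ and $S_i(X)\subseteq X$ for all $i$. Assume that $\underline{\dim}_{\mathrm B}C\ge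 n-1$ and that there is $\kappa>0$ such that $$N_\delta(S_{\mathbf i}(C))\ \ge\ \kappa\,N_\delta(S_{\mathbf i}(X))\qquad\text{for all }\delta\in(0,1]\text{ and }\mathbf i\in\mathcal I_n(\delta).$$ Then $$\overline{\dim}_{\mathrm B}F_C=\max\{s,\overline{\dim}_{\mathrm B}C\}\quad\text{and}\quad \max\{s,\underline{\dim}_{\mathrm B}C\}\le\underline{\dim}_{\mathrm B}F_C\le\max\{s,\overline{\dim}_{\mathrm B}C\}.$$ -/

import Mathlib

open Set Filter Topology

noncomputable section

namespace AffineIFS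

/-- Euclidean space `ℝⁿ`. -/
abbrev Space (n : ℕ) : Type := EuclideanSpace ℝ (Fin n)

/-! ### Box dimensions -/

/-- The closed axis-parallel hypercube of sidelength `δ` with lowest corner `a`. -/
def cube {n : ℕ} (a : Space n) (δ : ℝ) : Set (Space n) :=
  {x | ∀ j, a j ≤ x j ∧ x j ≤ a j + δ}

/-- `N_δ(F)`: the least number of hypercubes of sidelength `δ` that cover `F`
(meaningful for bounded `F` and `δ > 0`). -/
def coverNum {n : ℕ} (δ : ℝ) (F : Set (Space n)) : ℕ :=
  sInf {k : ℕ | ∃ t : Finset (Space n), t.card = k ∧ F ⊆ ⋃ a ∈ t, cube a δ}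

/-- Upper box dimension, computed in the extended reals so that the upper limit always exists. -/
def upperBoxDim {n : ℕ} (F : Set (Space n)) : EReal :=
  limsup (fun δ : ℝ => ((Real.log (coverNum δ F) / -Real.log δ : ℝ) : EReal)) (𝓝[>] 0)

/-- Lower box dimension, computed in the extended reals so that the lower limit always exists. -/
def lowerBoxDim {n : ℕ} (F : Set (Space n)) : EReal :=
  liminf (fun δ : ℝ => ((Real.log (coverNum δ F) / -Real.log δ : ℝ) : EReal)) (𝓝[>] 0)

/-! ### Affine iterated function systems -/

/-- An invertible affine map `x ↦ A x + b` is contracting. -/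
def IsContracting {n : ℕ} (f : Space n ≃ᵃ[ℝ] Space n) : Prop :=
  ∃ c : ℝ, 0 < c ∧ c < 1 ∧ ∀ x y, dist (f x) (f y) ≤ c * dist x y

/-- `S_w = S_{i₁} ∘ ⋯ ∘ S_{iₖ}` for the word `w = (i₁, …, iₖ)`; the product in the group of affine
automorphisms is composition, and the empty word gives the identity. -/
def wordMap {n N : ℕ} (S : Fin N → (Space n ≃ᵃ[ℝ] Space n)) (w : List (Fin N)) :
    Space n ≃ᵃ[ℝ] Space n :=
  (w.map S).prod

/-- `F` is the inhomogeneous attractor of `S` with condensation set `C`: the non-empty compact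
set with `F = ⋃ i, S i (F) ∪ C`. -/
def IsInhomogeneousAttractor {n N : ℕ} (S : Fin N → (Space n ≃ᵃ[ℝ] Space n))
    (C F : Set (Space n)) : Prop :=
  F.Nonempty ∧ IsCompact F ∧ F = (⋃ i, S i '' F) ∪ C

/-- The condensation open set condition. -/
def CondensationOSC {n N : ℕ} (S : Fin N → (Space n ≃ᵃ[ℝ] Space n)) (C : Set (Space n)) : Prop :=
  ∃ U : Set (Space n), IsOpen U ∧ C ⊆ U \ (⋃ i, closure (S i '' U)) ∧
    (∀ i, S i '' U ⊆ U) ∧ ∀ i j, i ≠ j → Disjoint (S i '' U) (S j '' U)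

/-! ### Singular values and the affinity dimension -/

/-- `α_m(f)`, for `1 ≤ m ≤ n`: the `m`-th largest singular value (counted from `1`) of the linear
part of `f`. Mathlib lists singular values in decreasing order, counted from `0`. -/
def singVal {n : ℕ} (m : ℕ) (f : Space n ≃ᵃ[ℝ] Space n) : ℝ :=
  (f.linear : Space n →ₗ[ℝ] Space n).singularValues (m - 1)

/-- The singular value function `φ^t(f)` for `t ≥ 0`: it is `1` for `t = 0`, it is
`α₁ ⋯ α_{m-1} α_m ^ (t - m + 1)` for `m - 1 < t ≤ m ≤ n`, and `|det| ^ (t / n)` for `t > n`. -/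
def phi {n : ℕ} (t : ℝ) (f : Space n ≃ᵃ[ℝ] Space n) : ℝ :=
  if t ≤ 0 then 1
  else if t ≤ n then
    (∏ j ∈ Finset.Icc 1 (⌈t⌉₊ - 1), singVal j f) * singVal ⌈t⌉₊ f ^ (t - (⌈t⌉₊ : ℝ) + 1)
  else |LinearMap.det (f.linear : Space n →ₗ[ℝ] Space n)| ^ (t / n)

/-- `s` is the affinity dimension of `S`: the limit of the sequence `(s_k)` where, for `k ≥ 1`,
`s_k ≥ 0` is the solution of `∑_{w of length k} φ^{s_k}(S_w) = 1`. -/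
def IsAffinityDimension {n N : ℕ} (S : Fin N → (Space n ≃ᵃ[ℝ] Space n)) (s : ℝ) : Prop :=
  ∃ u : ℕ → ℝ,
    (∀ k, 1 ≤ k → 0 ≤ u k ∧
      ∑ w : Fin k → Fin N, phi (u k) (wordMap S (List.ofFn w)) = 1) ∧
    Tendsto u atTop (𝓝 s)

/-- The `m`-`δ`-stopping: the non-empty words `w` with `α_m(S_w) < δ ≤ α_m(S_{w₋})`, where `w₋` is
`w` without its last letter. -/
def stopping {n N : ℕ} (S : Fin N → (Space n ≃ᵃ[ℝ] Space n)) (m : ℕ) (δ : ℝ) :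
    Set (List (Fin N)) :=
  {w | w ≠ [] ∧ singVal m (wordMap S w) < δ ∧ δ ≤ singVal m (wordMap S w.dropLast)}

end AffineIFS

end

noncomputable section

namespace AffineIFS

/-! ### Products of singular values -/

/-! The relevant exponents satisfy n - 1 < t ≤ n, where φ^t = |det| · α_n^(t-n)
(`phi_of_mem_top_Ioc`). There φ^t only sees volume and the smallest singular value, so covering
numbers of affine images can be estimated by volume. The assumption that C has lower box dimension
at least n - 1 is what confines the argument to this range.

Upper bound: take t above s and the upper box dimension of C. If t > n there is nothing to do.
Otherwise, iterating the equation of F until α_n drops below δ covers F by copies of C with α_n ≥ δ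
and stopped copies of F with α_n comparable to δ (`attractor_subset`). Each copy needs at most a
constant times δ^(-t) φ^t cubes, and the sum of φ^t over all words converges because t > s.

Lower bound: C ⊆ F gives monotonicity, so only s remains. If the lower dimension of F were below s,
some t would lie between them, and t > n - 1 automatically; the open set condition and a volume
count give s ≤ n. Below s, the stopped words have total φ^t at least 1 (`one_le_sum_stopping`).
Volume and the hypothesis with κ give each stopped copy of C at least a constant times δ^(-t) φ^t
cubes, and one cube meets boundedly many copies (`card_filter_inter_nonempty_le`), so the counts add
up.

Convergence of s_k and both statements about sums of φ^t rest on submultiplicativity of φ^t. It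
follows from that of α₁⋯α_m, which is the largest factor by which a linear map can scale
m-dimensional volume; Gram determinants express this volume. -/

theorem transpose_mul_diagonal_mul_apply {m n : ℕ} (U : Matrix (Fin n) (Fin m) ℝ)
    (d : Fin n → ℝ) (i j : Fin m) :
    (U.transpose * Matrix.diagonal d * U) i j = ∑ k, U k i * d k * U k j := by
  rw [Matrix.mul_apply]
  exact Finset.sum_congr rfl fun k _ => by rw [Matrix.mul_diagonal, Matrix.transpose_apply]

/-- A symmetrised Cauchy–Binet formula: the sum runs over all functions instead of subsets. -/
theorem factorial_mul_det_transpose_mul_diagonal_mul {m n : ℕ} (U : Matrix (Fin n) (Fin m) ℝ)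
    (d : Fin n → ℝ) :
    (m.factorial : ℝ) * (U.transpose * Matrix.diagonal d * U).det =
      ∑ f : Fin m → Fin n, (∏ i, d (f i)) * (U.submatrix f id).det ^ 2 := by
  -- Row i of the product is a combination of the rows of U, and the determinant is multilinear in
  -- rows.
  have h1 : (U.transpose * Matrix.diagonal d * U).det =
      ∑ f : Fin m → Fin n, (∏ i, d (f i)) * (∏ i, U (f i) i) * (U.submatrix f id).det := by
    have hrow : (U.transpose * Matrix.diagonal d * U) =
        Matrix.of fun i => ∑ k, (d k * U k i) • U k := by
      ext i j
      simp only [transpose_mul_diagonal_mul_apply, Matrix.of_apply, Finset.sum_apply,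
        Pi.smul_apply, smul_eq_mul]
      exact Finset.sum_congr rfl fun k _ => by ring
    have h2 := (Matrix.detRowAlternating (n := Fin m) (R := ℝ)).toMultilinearMap.map_sum
      (fun (i : Fin m) (k : Fin n) => (d k * U k i) • U k)
    rw [hrow]
    refine h2.trans (Finset.sum_congr rfl fun f _ => ?_)
    have h3 := (Matrix.detRowAlternating (n := Fin m) (R := ℝ)).toMultilinearMap.map_smul_univ
      (fun i => d (f i) * U (f i) i) (fun i => U (f i))
    refine h3.trans ?_
    rw [Finset.prod_mul_distrib, smul_eq_mul]
    rfl
  -- Replacing f by f ∘ σ keeps the product of the d's and changes the minor by sign σ. Summing over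
  -- σ then assembles the Leibniz expansion of a second copy of the minor.
  have h2 : ∀ σ : Equiv.Perm (Fin m), (U.transpose * Matrix.diagonal d * U).det =
      ∑ f : Fin m → Fin n, (∏ i, d (f i)) * (U.submatrix f id).det *
        (Equiv.Perm.sign σ * ∏ i, U (f (σ i)) i) := by
    intro σ
    rw [h1, ← Equiv.sum_comp (Equiv.arrowCongr σ.symm (Equiv.refl (Fin n)))]
    refine Finset.sum_congr rfl fun f _ => ?_
    have e1 : ∀ i, (Equiv.arrowCongr σ.symm (Equiv.refl (Fin n))) f i = f (σ i) := fun i => rfl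
    have e2 : U.submatrix ((Equiv.arrowCongr σ.symm (Equiv.refl (Fin n))) f) id =
        (U.submatrix f id).submatrix σ id := rfl
    rw [e2, Matrix.det_permute]
    simp only [e1]
    rw [Equiv.prod_comp σ (fun i => d (f i))]
    ring
  have h3 : ∑ _σ : Equiv.Perm (Fin m), (U.transpose * Matrix.diagonal d * U).det =
      ∑ f : Fin m → Fin n, (∏ i, d (f i)) * (U.submatrix f id).det ^ 2 := by
    rw [Finset.sum_congr rfl fun σ _ => h2 σ, Finset.sum_comm]
    refine Finset.sum_congr rfl fun f _ => ?_
    rw [← Finset.mul_sum, sq, ← mul_assoc]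
    congr 1
    rw [Matrix.det_apply']
    rfl
  rw [← h3]
  simp [Fintype.card_perm]

theorem le_apply_of_strictMono {m n : ℕ} {g : Fin m → Fin n} (hg : StrictMono g) (i : Fin m) :
    (i : ℕ) ≤ g i := by
  obtain ⟨i, hi⟩ := i
  induction i with
  | zero => exact Nat.zero_le _
  | succ k ih =>
    have h1 := ih (by omega)
    have h2 : g ⟨k, by omega⟩ < g ⟨k + 1, hi⟩ := hg (by simp)
    have h3 : (g ⟨k, by omega⟩ : ℕ) < g ⟨k + 1, hi⟩ := h2
    simp only at h1 ⊢
    omega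

/-- A product of distinct terms of a nonnegative antitone sequence is at most the product of its
first terms. -/
theorem prod_apply_le_prod_of_injective {m n : ℕ} {a : ℕ → ℝ} (ha : Antitone a) (h0 : ∀ i, 0 ≤ a i)
    {f : Fin m → Fin n} (hf : Function.Injective f) :
    ∏ i, a (f i) ≤ ∏ i : Fin m, a i := by
  classical
  set s : Finset (Fin n) := Finset.univ.image f with hs
  have hcard : s.card = m := by rw [hs, Finset.card_image_of_injective _ hf]; simp
  have h1 : ∏ i, a (f i) = ∏ x ∈ s, a x := by
    rw [hs, Finset.prod_image (fun x _ y _ h => hf h)]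
  -- With the indices in increasing order, the i-th is at least i, so factors can be compared one by
  -- one.
  have h2 : ∏ x ∈ s, a x = ∏ i : Fin m, a (s.orderEmbOfFin hcard i) := by
    conv_lhs => rw [← Finset.image_orderEmbOfFin_univ s hcard]
    rw [Finset.prod_image (fun x _ y _ h => (s.orderEmbOfFin hcard).injective h)]
  rw [h1, h2]
  exact Finset.prod_le_prod (fun i _ => h0 _) fun i _ =>
    ha (le_apply_of_strictMono (s.orderEmbOfFin hcard).strictMono i)

section SingularValues

variable {E : Type*} [NormedAddCommGroup E] [InnerProductSpace ℝ E] [FiniteDimensional ℝ E]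

open Module in
/-- The Gram matrix of the image of a family in the eigenbasis of `T* T`. -/
theorem gram_map_eq {n m : ℕ} (hn : finrank ℝ E = n) (T : E →ₗ[ℝ] E) (v : Fin m → E) :
    Matrix.gram ℝ (fun i => T (v i)) =
      (Matrix.of fun k i =>
        (inner ℝ (T.isSymmetric_adjoint_comp_self.eigenvectorBasis hn k) (v i) : ℝ)).transpose *
      Matrix.diagonal (fun k : Fin n => T.singularValues k ^ 2) *
      (Matrix.of fun k i =>
        (inner ℝ (T.isSymmetric_adjoint_comp_self.eigenvectorBasis hn k) (v i) : ℝ)) := by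
  ext i j
  set b := T.isSymmetric_adjoint_comp_self.eigenvectorBasis hn
  simp only [Matrix.gram_apply, transpose_mul_diagonal_mul_apply, Matrix.of_apply]
  have h1 : (inner ℝ (T (v i)) (T (v j)) : ℝ) = inner ℝ (v i) ((T.adjoint ∘ₗ T) (v j)) := by
    rw [LinearMap.comp_apply, LinearMap.adjoint_inner_right]
  rw [h1, ← b.sum_inner_mul_inner]
  refine Finset.sum_congr rfl fun k _ => ?_
  have h2 : (inner ℝ (b k) ((T.adjoint ∘ₗ T) (v j)) : ℝ) =
      T.singularValues k ^ 2 * inner ℝ (b k) (v j) := by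
    rw [← T.isSymmetric_adjoint_comp_self, T.isSymmetric_adjoint_comp_self.apply_eigenvectorBasis,
      T.sq_singularValues_fin hn]
    simp [inner_smul_left, b]
  rw [h2, real_inner_comm]
  ring

-- Unit weights give the same shape as `gram_map_eq`, so the two determinant expansions can be
-- compared term by term.
omit [FiniteDimensional ℝ E] in
theorem gram_eq_transpose_mul {n m : ℕ} (b : OrthonormalBasis (Fin n) ℝ E) (v : Fin m → E) :
    Matrix.gram ℝ v = (Matrix.of fun k i => (inner ℝ (b k) (v i) : ℝ)).transpose *
      Matrix.diagonal (fun _ : Fin n => (1 : ℝ)) * (Matrix.of fun k i => (inner ℝ (b k) (v i) : ℝ)) := by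
  ext i j
  simp only [Matrix.gram_apply, transpose_mul_diagonal_mul_apply, Matrix.of_apply]
  rw [← b.sum_inner_mul_inner]
  exact Finset.sum_congr rfl fun k _ => by rw [real_inner_comm, mul_one]

open Module in
/-- A linear map multiplies the Gram determinant of `m` vectors at most by the square of the
product of its `m` largest singular values. -/
theorem det_gram_map_le {m : ℕ} (T : E →ₗ[ℝ] E) (v : Fin m → E) :
    (Matrix.gram ℝ fun i => T (v i)).det ≤
      (∏ j : Fin m, T.singularValues j) ^ 2 * (Matrix.gram ℝ v).det := by
  set b := T.isSymmetric_adjoint_comp_self.eigenvectorBasis rfl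
  have hm : (0 : ℝ) < m.factorial := by exact_mod_cast m.factorial_pos
  refine le_of_mul_le_mul_left ?_ hm
  rw [gram_map_eq rfl, gram_eq_transpose_mul b, mul_left_comm,
    factorial_mul_det_transpose_mul_diagonal_mul, factorial_mul_det_transpose_mul_diagonal_mul,
    Finset.mul_sum]
  refine Finset.sum_le_sum fun f _ => ?_
  -- A non-injective f repeats a row, so its minor vanishes; only products of distinct singular
  -- values remain.
  by_cases hf : Function.Injective f
  · rw [Finset.prod_const_one, one_mul, Finset.prod_pow]
    gcongr ?_ ^ 2 * _
    · exact Finset.prod_nonneg fun _ _ => T.singularValues_nonneg _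
    · exact prod_apply_le_prod_of_injective T.singularValues_antitone T.singularValues_nonneg hf
  · obtain ⟨i, j, hij, hne⟩ : ∃ i j, f i = f j ∧ i ≠ j := by
      simpa [Function.Injective] using hf
    have h0 : ∀ U : Matrix (Fin (finrank ℝ E)) (Fin m) ℝ, (U.submatrix f id).det = 0 := fun U =>
      Matrix.det_zero_of_row_eq hne (by ext k; simp [hij])
    simp [h0]

open Module in
/-- The singular vectors of the largest singular values realise the product of these. -/
theorem exists_gram_map_det_eq {m : ℕ} (hm : m ≤ finrank ℝ E) (T : E →ₗ[ℝ] E) :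
    ∃ v : Fin m → E, (Matrix.gram ℝ v).det = 1 ∧
      (Matrix.gram ℝ fun i => T (v i)).det = (∏ j : Fin m, T.singularValues j) ^ 2 := by
  set b := T.isSymmetric_adjoint_comp_self.eigenvectorBasis rfl
  refine ⟨fun i => b (Fin.castLE hm i), ?_, ?_⟩
  · rw [(Matrix.gram_eq_one_iff_orthonormal).2, Matrix.det_one]
    exact b.orthonormal.comp _ (Fin.castLE_injective hm)
  · have : (Matrix.gram ℝ fun i => T (b (Fin.castLE hm i))) =
        Matrix.diagonal fun i : Fin m => T.singularValues i ^ 2 := by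
      ext i j
      rw [Matrix.gram_apply, ← LinearMap.adjoint_inner_right, ← LinearMap.comp_apply,
        T.isSymmetric_adjoint_comp_self.apply_eigenvectorBasis, ← T.sq_singularValues_fin rfl,
        inner_smul_right, b.inner_eq_ite, Matrix.diagonal_apply]
      by_cases hij : i = j
      · subst hij; simp
      · simp [hij]
    rw [this, Matrix.det_diagonal, Finset.prod_pow]

open Module in
/-- The product of the `m` largest singular values is submultiplicative. -/
theorem prod_singularValues_comp_le {m : ℕ} (hm : m ≤ finrank ℝ E) (A B : E →ₗ[ℝ] E) :
    ∏ j ∈ Finset.range m, (A ∘ₗ B).singularValues j ≤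
      (∏ j ∈ Finset.range m, A.singularValues j) * ∏ j ∈ Finset.range m, B.singularValues j := by
  have hnn : ∀ T : E →ₗ[ℝ] E, 0 ≤ ∏ j : Fin m, T.singularValues j := fun T =>
    Finset.prod_nonneg fun _ _ => T.singularValues_nonneg _
  -- An extremal family for the composite is a competitor for B, and its image under B is one for A.
  obtain ⟨v, hv, h⟩ := exists_gram_map_det_eq hm (A ∘ₗ B)
  simp only [Finset.prod_range]
  refine le_of_sq_le_sq ?_ (mul_nonneg (hnn A) (hnn B))
  rw [← h, mul_pow]
  have h1 := det_gram_map_le A (fun i => B (v i))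
  have h2 := det_gram_map_le B v
  rw [hv, mul_one] at h2
  exact h1.trans (mul_le_mul_of_nonneg_left h2 (sq_nonneg _))

open Module in
theorem prod_singularValues_eq_abs_det (T : E →ₗ[ℝ] E) {n : ℕ} (hn : finrank ℝ E = n) :
    ∏ j ∈ Finset.range n, T.singularValues j = |LinearMap.det T| := by
  rw [← T.normDet_eq_abs_det, T.normDet_eq_prod_singularValues, hn]

open Module in
theorem norm_map_sq_eq {n : ℕ} (hn : finrank ℝ E = n) (T : E →ₗ[ℝ] E) (x : E) :
    ‖T x‖ ^ 2 = ∑ k : Fin n, T.singularValues k ^ 2 *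
      (inner ℝ (T.isSymmetric_adjoint_comp_self.eigenvectorBasis hn k) x : ℝ) ^ 2 := by
  -- The 1 × 1 Gram matrix of a single vector.
  have h := congrFun (congrFun (gram_map_eq hn T (fun _ : Fin 1 => x)) 0) 0
  rw [Matrix.gram_apply, real_inner_self_eq_norm_sq] at h
  rw [h, Matrix.mul_apply]
  refine Finset.sum_congr rfl fun k _ => ?_
  simp only [Matrix.mul_diagonal, Matrix.transpose_apply, Matrix.of_apply]
  ring

omit [FiniteDimensional ℝ E] in
theorem norm_sq_eq_sum_inner {n : ℕ} (b : OrthonormalBasis (Fin n) ℝ E) (x : E) :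
    ‖x‖ ^ 2 = ∑ k : Fin n, (inner ℝ (b k) x : ℝ) ^ 2 := by
  rw [← b.sum_sq_norm_inner_right]
  simp

open Module in
theorem singularValues_last_mul_norm_le {n : ℕ} (hn : finrank ℝ E = n) (T : E →ₗ[ℝ] E) (x : E) :
    T.singularValues (n - 1) * ‖x‖ ≤ ‖T x‖ := by
  refine le_of_sq_le_sq ?_ (norm_nonneg _)
  rw [mul_pow, norm_map_sq_eq hn,
    norm_sq_eq_sum_inner (T.isSymmetric_adjoint_comp_self.eigenvectorBasis hn) x, Finset.mul_sum]
  gcongr with k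
  · exact T.singularValues_nonneg _
  · exact T.singularValues_antitone (by omega)

open Module in
theorem exists_norm_map_eq_singularValues {n : ℕ} (hn : finrank ℝ E = n) (T : E →ₗ[ℝ] E) {k : ℕ}
    (hk : k < n) : ∃ x : E, ‖x‖ = 1 ∧ ‖T x‖ = T.singularValues k := by
  set b := T.isSymmetric_adjoint_comp_self.eigenvectorBasis hn
  refine ⟨b ⟨k, hk⟩, b.orthonormal.1 _, ?_⟩
  refine (sq_eq_sq₀ (norm_nonneg _) (T.singularValues_nonneg _)).1 ?_
  rw [norm_map_sq_eq hn, Finset.sum_eq_single ⟨k, hk⟩]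
  · simp [b]
  · intro j _ hj
    simp [b.inner_eq_ite, hj, b]
  · simp

end SingularValues

/-! ### The singular value function -/

section SingularValueFunction

variable {n : ℕ}

/-- The absolute value of the determinant of the linear part. -/
def absDet (f : Space n ≃ᵃ[ℝ] Space n) : ℝ :=
  |LinearMap.det (f.linear : Space n →ₗ[ℝ] Space n)|

theorem absDet_pos (f : Space n ≃ᵃ[ℝ] Space n) : 0 < absDet f :=
  abs_pos.2 (LinearEquiv.isUnit_det' f.linear).ne_zero

theorem coe_linear_mul (f g : Space n ≃ᵃ[ℝ] Space n) :
    ((f * g).linear : Space n →ₗ[ℝ] Space n) =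
      (f.linear : Space n →ₗ[ℝ] Space n) ∘ₗ (g.linear : Space n →ₗ[ℝ] Space n) := rfl

theorem absDet_mul (f g : Space n ≃ᵃ[ℝ] Space n) : absDet (f * g) = absDet f * absDet g := by
  rw [absDet, coe_linear_mul, LinearMap.det_comp, abs_mul, absDet, absDet]

theorem singVal_pos (f : Space n ≃ᵃ[ℝ] Space n) {m : ℕ} (hm : m - 1 < n) : 0 < singVal m f := by
  have h := (LinearMap.injective_iff_forall_lt_finrank_singularValues_pos
    (T := (f.linear : Space n →ₗ[ℝ] Space n))).1 f.linear.injective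
  exact h _ (by simpa using hm)

theorem singVal_nonneg (f : Space n ≃ᵃ[ℝ] Space n) (m : ℕ) : 0 ≤ singVal m f :=
  LinearMap.singularValues_nonneg _ _

theorem singVal_mul_norm_le (f : Space n ≃ᵃ[ℝ] Space n) (x : Space n) :
    singVal n f * ‖x‖ ≤ ‖f.linear x‖ :=
  singularValues_last_mul_norm_le finrank_euclideanSpace_fin
    (f.linear : Space n →ₗ[ℝ] Space n) x

theorem exists_norm_linear_eq_singVal (f : Space n ≃ᵃ[ℝ] Space n) {m : ℕ} (hm : m - 1 < n) :
    ∃ x : Space n, ‖x‖ = 1 ∧ ‖f.linear x‖ = singVal m f :=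
  exists_norm_map_eq_singularValues finrank_euclideanSpace_fin
    (f.linear : Space n →ₗ[ℝ] Space n) hm

theorem singVal_mul_singVal_le (hn : 1 ≤ n) (f g : Space n ≃ᵃ[ℝ] Space n) :
    singVal n f * singVal n g ≤ singVal n (f * g) := by
  obtain ⟨x, hx, h⟩ := exists_norm_linear_eq_singVal (f * g) (m := n) (by omega)
  rw [← h]
  have h1 := singVal_mul_norm_le f (g.linear x)
  have h2 := singVal_mul_norm_le g x
  rw [hx, mul_one] at h2
  exact (mul_le_mul_of_nonneg_left h2 (singVal_nonneg f n)).trans h1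

/-- Pull the unit vector that f shrinks most back through g: the preimage has norm at least 1 / c
and is sent to norm α_n(f). -/
theorem singVal_mul_le_of_norm_le (hn : 1 ≤ n) (f g : Space n ≃ᵃ[ℝ] Space n) {c : ℝ}
    (hg : ∀ x, ‖g.linear x‖ ≤ c * ‖x‖) : singVal n (f * g) ≤ singVal n f * c := by
  obtain ⟨x, hx, h⟩ := exists_norm_linear_eq_singVal f (m := n) (by omega)
  set y := g.linear.symm x with hy
  have hgy : g.linear y = x := g.linear.apply_symm_apply x
  have h1 := singVal_mul_norm_le (f * g) y
  have h2 : (f * g).linear y = f.linear (g.linear y) := rfl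
  rw [h2, hgy, h] at h1
  have h3 := hg y
  rw [hgy, hx] at h3
  have hy0 : 0 < ‖y‖ := by
    rw [norm_pos_iff]
    intro h0
    rw [h0, map_zero] at hgy
    rw [← hgy, norm_zero] at hx
    exact zero_ne_one hx
  have h4 : singVal n (f * g) * ‖y‖ ≤ singVal n f * c * ‖y‖ := by
    calc singVal n (f * g) * ‖y‖ ≤ singVal n f * 1 := by rw [mul_one]; exact h1
      _ ≤ singVal n f * (c * ‖y‖) := mul_le_mul_of_nonneg_left h3 (singVal_nonneg f n)
      _ = _ := by ring
  exact le_of_mul_le_mul_right h4 hy0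

theorem singVal_le_of_norm_le (f : Space n ≃ᵃ[ℝ] Space n) {c : ℝ}
    (hf : ∀ x, ‖f.linear x‖ ≤ c * ‖x‖) {m : ℕ} (hm : m - 1 < n) : singVal m f ≤ c := by
  obtain ⟨x, hx, h⟩ := exists_norm_linear_eq_singVal f hm
  have := hf x
  rwa [hx, mul_one, h] at this

theorem singVal_one_eq_one (hn : 1 ≤ n) : singVal n (1 : Space n ≃ᵃ[ℝ] Space n) = 1 := by
  obtain ⟨x, hx, h⟩ := exists_norm_linear_eq_singVal (1 : Space n ≃ᵃ[ℝ] Space n) (m := n) (by omega)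
  rw [← h, ← hx]
  rfl

/-- The product of the `m` largest singular values. -/
def svProd (m : ℕ) (f : Space n ≃ᵃ[ℝ] Space n) : ℝ :=
  ∏ j ∈ Finset.range m, singVal (j + 1) f

theorem svProd_succ (m : ℕ) (f : Space n ≃ᵃ[ℝ] Space n) :
    svProd (m + 1) f = svProd m f * singVal (m + 1) f := Finset.prod_range_succ _ _

theorem svProd_pos {m : ℕ} (hm : m ≤ n) (f : Space n ≃ᵃ[ℝ] Space n) : 0 < svProd m f :=
  Finset.prod_pos fun j hj => singVal_pos f (by have := Finset.mem_range.1 hj; omega)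

theorem svProd_mul_le {m : ℕ} (hm : m ≤ n) (f g : Space n ≃ᵃ[ℝ] Space n) :
    svProd m (f * g) ≤ svProd m f * svProd m g :=
  prod_singularValues_comp_le (by simpa using hm) (f.linear : Space n →ₗ[ℝ] Space n)
    (g.linear : Space n →ₗ[ℝ] Space n)

theorem svProd_self (f : Space n ≃ᵃ[ℝ] Space n) : svProd n f = absDet f :=
  prod_singularValues_eq_abs_det _ finrank_euclideanSpace_fin

theorem phi_of_nonpos {t : ℝ} (ht : t ≤ 0) (f : Space n ≃ᵃ[ℝ] Space n) : phi t f = 1 := by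
  rw [phi, if_pos ht]

theorem phi_of_lt {t : ℝ} (ht : (n : ℝ) < t) (f : Space n ≃ᵃ[ℝ] Space n) :
    phi t f = absDet f ^ (t / n) := by
  have h0 : ¬ t ≤ 0 := not_le.2 ((Nat.cast_nonneg n).trans_lt ht)
  rw [phi, if_neg h0, if_neg (not_le.2 ht)]
  rfl

theorem phi_of_mem_Ioc {m : ℕ} {t : ℝ} (hm : m + 1 ≤ n) (h1 : (m : ℝ) < t) (h2 : t ≤ m + 1)
    (f : Space n ≃ᵃ[ℝ] Space n) : phi t f = svProd m f * singVal (m + 1) f ^ (t - m) := by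
  have h0 : ¬ t ≤ 0 := not_le.2 ((Nat.cast_nonneg m).trans_lt h1)
  have hmn : (m : ℝ) + 1 ≤ n := by exact_mod_cast hm
  have hc : ⌈t⌉₊ = m + 1 := by
    rw [Nat.ceil_eq_iff (by omega)]
    constructor
    · simpa using h1
    · push_cast; exact h2
  rw [phi, if_neg h0, if_pos (h2.trans hmn), hc]
  congr 1
  · rw [svProd, Nat.add_sub_cancel, Finset.range_eq_Ico,
      Finset.prod_Ico_add' (fun j => singVal j f) 0 m 1]
    rfl
  · congr 1; push_cast; ring

/-- Here α₁⋯α_(n-1) = |det| / α_n. This is the form that turns volume estimates into estimates by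
φ^t. -/
theorem phi_of_mem_top_Ioc (hn : 1 ≤ n) {t : ℝ} (h1 : (n : ℝ) - 1 < t) (h2 : t ≤ n)
    (f : Space n ≃ᵃ[ℝ] Space n) : phi t f = absDet f * singVal n f ^ (t - n) := by
  obtain ⟨m, rfl⟩ : ∃ m, n = m + 1 := ⟨n - 1, by omega⟩
  push_cast at h1 h2 ⊢
  rw [phi_of_mem_Ioc le_rfl (by linarith) h2, ← svProd_self, svProd_succ, mul_assoc]
  have hp := singVal_pos f (m := m + 1) (by omega)
  congr 1
  rw [show t - m = 1 + (t - (m + 1)) by ring, Real.rpow_add hp, Real.rpow_one]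

/-- The exponent of the `j`-th singular value (counted from `0`) in `φ^t`. -/
def svExponent (t : ℝ) (j : ℕ) : ℝ := max 0 (min 1 (t - j))

theorem svExponent_mono {t t' : ℝ} (h : t ≤ t') (j : ℕ) : svExponent t j ≤ svExponent t' j := by
  unfold svExponent; gcongr

theorem sum_svExponent {t : ℝ} (ht : 0 ≤ t) (n : ℕ) :
    ∑ j ∈ Finset.range n, svExponent t j = min t n := by
  induction n with
  | zero => simp [ht]
  | succ n ih =>
    rw [Finset.sum_range_succ, ih, svExponent]
    push_cast
    rcases le_total t n with h | h
    · rw [min_eq_left h, min_eq_right (by linarith), max_eq_left (by linarith),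
        min_eq_left (by linarith), add_zero]
    · rw [min_eq_right h]
      rcases le_total t (n + 1) with h' | h'
      · rw [min_eq_right (by linarith), max_eq_right (by linarith), min_eq_left h']; ring
      · rw [min_eq_left (by linarith), max_eq_right (by linarith), min_eq_right h']

/-- One formula for all t, with exponents continuous and monotone in t; continuity and decay of φ^t
are read off from it. -/
theorem phi_eq_prod (t : ℝ) (f : Space n ≃ᵃ[ℝ] Space n) :
    phi t f = (∏ j ∈ Finset.range n, singVal (j + 1) f ^ svExponent t j) *
      absDet f ^ (max 0 (t - n) / n) := by
  rcases le_or_gt t 0 with h0 | h0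
  · have h1 : ∀ j : ℕ, svExponent t j = 0 := fun j =>
      max_eq_left ((min_le_right _ _).trans (by have : (0 : ℝ) ≤ j := Nat.cast_nonneg j; linarith))
    have h2 : max 0 (t - n) = 0 :=
      max_eq_left (by have : (0 : ℝ) ≤ n := Nat.cast_nonneg n; linarith)
    rw [phi_of_nonpos h0, h2]
    simp [h1]
  rcases lt_or_ge (n : ℝ) t with h | h
  · have h1 : ∏ j ∈ Finset.range n, singVal (j + 1) f ^ svExponent t j = absDet f := by
      rw [← svProd_self]
      refine Finset.prod_congr rfl fun j hj => ?_
      have hj : (j : ℝ) + 1 ≤ n := by exact_mod_cast Finset.mem_range.1 hj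
      rw [svExponent, min_eq_left (by linarith), max_eq_right zero_le_one, Real.rpow_one]
    rw [phi_of_lt h, h1, max_eq_right (by linarith)]
    rcases Nat.eq_zero_or_pos n with hn | hn
    · subst hn
      rw [← svProd_self]; simp [svProd]
    · have hn' : (0 : ℝ) < n := by exact_mod_cast hn
      rw [show t / n = 1 + (t - n) / n by field_simp; ring, Real.rpow_add (absDet_pos f),
        Real.rpow_one]
  · obtain ⟨m, hm⟩ : ∃ m, ⌈t⌉₊ = m + 1 := ⟨⌈t⌉₊ - 1, by have := Nat.ceil_pos.2 h0; omega⟩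
    have h1 : (m : ℝ) < t := by
      have := Nat.ceil_lt_add_one h0.le
      rw [hm] at this; push_cast at this; linarith
    have h2 : t ≤ m + 1 := by have := Nat.le_ceil t; rw [hm] at this; exact_mod_cast this
    have hmn : m + 1 ≤ n := by rw [← hm]; exact Nat.ceil_le.2 h
    rw [phi_of_mem_Ioc hmn h1 h2, max_eq_left (by linarith), zero_div, Real.rpow_zero, mul_one]
    obtain ⟨r, rfl⟩ := Nat.exists_eq_add_of_le hmn
    rw [Finset.prod_range_add, Finset.prod_range_succ, svProd]
    have e1 : ∏ j ∈ Finset.range m, singVal (j + 1) f ^ svExponent t j =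
        ∏ j ∈ Finset.range m, singVal (j + 1) f := by
      refine Finset.prod_congr rfl fun j hj => ?_
      have hj : (j : ℝ) + 1 ≤ m := by exact_mod_cast Finset.mem_range.1 hj
      rw [svExponent, min_eq_left (by linarith), max_eq_right zero_le_one, Real.rpow_one]
    have e2 : ∏ j ∈ Finset.range r, singVal (m + 1 + j + 1) f ^ svExponent t (m + 1 + j) = 1 := by
      refine Finset.prod_eq_one fun j _ => ?_
      rw [svExponent, max_eq_left, Real.rpow_zero]
      refine (min_le_right _ _).trans ?_
      push_cast
      have : (0 : ℝ) ≤ j := Nat.cast_nonneg j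
      linarith
    have e3 : svExponent t m = t - m := by
      rw [svExponent, min_eq_right (by linarith), max_eq_right (by linarith)]
    rw [e1, e2, e3, mul_one]

theorem phi_pos (t : ℝ) (f : Space n ≃ᵃ[ℝ] Space n) : 0 < phi t f := by
  rw [phi_eq_prod]
  refine mul_pos (Finset.prod_pos fun j hj => Real.rpow_pos_of_pos (singVal_pos f ?_) _)
    (Real.rpow_pos_of_pos (absDet_pos f) _)
  have := Finset.mem_range.1 hj
  omega

theorem continuous_phi (f : Space n ≃ᵃ[ℝ] Space n) : Continuous fun t => phi t f := by
  simp only [phi_eq_prod, svExponent]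
  refine Continuous.mul (continuous_finsetProd _ fun j hj => ?_) ?_
  · refine Continuous.rpow continuous_const (by fun_prop) fun t => Or.inl ?_
    exact (singVal_pos f (by have := Finset.mem_range.1 hj; omega)).ne'
  · exact Continuous.rpow continuous_const (by fun_prop) fun t => Or.inl (absDet_pos f).ne'

theorem absDet_le_pow (f : Space n ≃ᵃ[ℝ] Space n) {a : ℝ}
    (ha : ∀ m, m - 1 < n → singVal m f ≤ a) : absDet f ≤ a ^ n := by
  rw [← svProd_self, svProd]
  refine (Finset.prod_le_prod (fun j _ => singVal_nonneg f _) fun j hj => ha _ ?_).trans_eq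
    (by simp)
  have := Finset.mem_range.1 hj
  omega

theorem rpow_le_rpow_sub_mul {x a e e' : ℝ} (hx : 0 < x) (hxa : x ≤ a) (he : e ≤ e') :
    x ^ e' ≤ a ^ (e' - e) * x ^ e := by
  calc x ^ e' = x ^ (e' - e) * x ^ e := by rw [← Real.rpow_add hx]; congr 1; ring
    _ ≤ _ := by gcongr

/-- `φ^t` decays in `t` at least at the exponential rate given by a bound on the singular
values. -/
theorem phi_le_rpow_mul_phi (hn : 1 ≤ n) (f : Space n ≃ᵃ[ℝ] Space n) {a : ℝ}
    (ha : ∀ m, m - 1 < n → singVal m f ≤ a) {t t' : ℝ} (ht : 0 ≤ t) (htt : t ≤ t') :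
    phi t' f ≤ a ^ (t' - t) * phi t f := by
  have hn' : (0 : ℝ) < n := by exact_mod_cast hn
  have ha0 : 0 < a := (singVal_pos f (m := n) (by omega)).trans_le (ha n (by omega))
  -- The exponents of φ^t have total t when the determinant counts as n singular values, so the
  -- increments have total t' - t.
  have key : a ^ (t' - t) = (∏ j ∈ Finset.range n, a ^ (svExponent t' j - svExponent t j)) *
      (a ^ n) ^ (max 0 (t' - n) / n - max 0 (t - n) / n) := by
    rw [← Real.rpow_sum_of_pos ha0, ← Real.rpow_natCast a n, ← Real.rpow_mul ha0.le,
      ← Real.rpow_add ha0]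
    congr 1
    rw [Finset.sum_sub_distrib, sum_svExponent ht, sum_svExponent (ht.trans htt)]
    have e : ∀ u : ℝ, min u n + max 0 (u - n) = u := by
      intro u
      rcases le_total u n with h | h
      · rw [min_eq_left h, max_eq_left (by linarith), add_zero]
      · rw [min_eq_right h, max_eq_right (by linarith)]; ring
    have e1 := e t
    have e2 := e t'
    field_simp
    linarith
  rw [phi_eq_prod t', phi_eq_prod t, key]
  have h1 : ∏ j ∈ Finset.range n, singVal (j + 1) f ^ svExponent t' j ≤
      (∏ j ∈ Finset.range n, a ^ (svExponent t' j - svExponent t j)) *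
        ∏ j ∈ Finset.range n, singVal (j + 1) f ^ svExponent t j := by
    rw [← Finset.prod_mul_distrib]
    refine Finset.prod_le_prod (fun j _ => Real.rpow_nonneg (singVal_nonneg f _) _) fun j hj => ?_
    have hj : j + 1 - 1 < n := by have := Finset.mem_range.1 hj; omega
    exact rpow_le_rpow_sub_mul (singVal_pos f hj) (ha _ hj) (svExponent_mono htt j)
  have h2 := rpow_le_rpow_sub_mul (e := max 0 (t - n) / n) (e' := max 0 (t' - n) / n)
    (absDet_pos f) (absDet_le_pow f ha) (by gcongr)
  refine (mul_le_mul h1 h2 (Real.rpow_nonneg (absDet_pos f).le _) ?_).trans_eq (by ring)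
  exact mul_nonneg (Finset.prod_nonneg fun j _ => Real.rpow_nonneg ha0.le _)
    (Finset.prod_nonneg fun j _ => Real.rpow_nonneg (singVal_nonneg f _) _)

/-- The singular value function is submultiplicative. -/
theorem phi_mul_le (t : ℝ) (f g : Space n ≃ᵃ[ℝ] Space n) :
    phi t (f * g) ≤ phi t f * phi t g := by
  rcases le_or_gt t 0 with h0 | h0
  · simp [phi_of_nonpos h0]
  rcases lt_or_ge (n : ℝ) t with h | h
  · rw [phi_of_lt h, phi_of_lt h, phi_of_lt h, absDet_mul,
      Real.mul_rpow (absDet_pos f).le (absDet_pos g).le]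
  · obtain ⟨m, hm⟩ : ∃ m, ⌈t⌉₊ = m + 1 := ⟨⌈t⌉₊ - 1, by have := Nat.ceil_pos.2 h0; omega⟩
    have h1 : (m : ℝ) < t := by
      have := Nat.ceil_lt_add_one h0.le
      rw [hm] at this; push_cast at this; linarith
    have h2 : t ≤ m + 1 := by have := Nat.le_ceil t; rw [hm] at this; exact_mod_cast this
    have hmn : m + 1 ≤ n := by rw [← hm]; exact Nat.ceil_le.2 h
    -- On (m, m + 1], φ^t interpolates geometrically between the products of m and of m + 1 singular
    -- values, with nonnegative exponents; both products are submultiplicative.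
    have e : ∀ k : Space n ≃ᵃ[ℝ] Space n,
        phi t k = svProd m k ^ (m + 1 - t) * svProd (m + 1) k ^ (t - m) := by
      intro k
      have hp := svProd_pos (m := m) (by omega) k
      rw [phi_of_mem_Ioc hmn h1 h2, svProd_succ, Real.mul_rpow hp.le (singVal_nonneg k _),
        ← mul_assoc, ← Real.rpow_add hp, show (m : ℝ) + 1 - t + (t - m) = 1 by ring, Real.rpow_one]
    rw [e, e, e]
    have a1 := svProd_mul_le (m := m) (by omega) f g
    have a2 := svProd_mul_le hmn f g
    have p := fun k : Space n ≃ᵃ[ℝ] Space n => (svProd_pos (m := m) (by omega) k).le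
    have q := fun k : Space n ≃ᵃ[ℝ] Space n => (svProd_pos hmn k).le
    calc svProd m (f * g) ^ (m + 1 - t) * svProd (m + 1) (f * g) ^ (t - m)
        ≤ (svProd m f * svProd m g) ^ (m + 1 - t) *
            (svProd (m + 1) f * svProd (m + 1) g) ^ (t - m) := by
          refine mul_le_mul (Real.rpow_le_rpow (p _) a1 (by linarith))
            (Real.rpow_le_rpow (q _) a2 (by linarith)) (Real.rpow_nonneg (q _) _)
            (Real.rpow_nonneg (mul_nonneg (p _) (p _)) _)
      _ = _ := by
          rw [Real.mul_rpow (p f) (p g), Real.mul_rpow (q f) (q g)]; ring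

end SingularValueFunction

/-! ### Sums of the singular value function over words -/

section Words

variable {n N : ℕ} {S : Fin N → (Space n ≃ᵃ[ℝ] Space n)}

theorem wordMap_nil : wordMap S [] = 1 := rfl

theorem wordMap_cons (i : Fin N) (w : List (Fin N)) :
    wordMap S (i :: w) = S i * wordMap S w := by
  rw [wordMap, List.map_cons, List.prod_cons, wordMap]

theorem wordMap_append (v w : List (Fin N)) :
    wordMap S (v ++ w) = wordMap S v * wordMap S w := by
  rw [wordMap, List.map_append, List.prod_append, wordMap, wordMap]

theorem wordMap_singleton (i : Fin N) : wordMap S [i] = S i := by simp [wordMap]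

/-- The words of length `k`. -/
def words (N k : ℕ) : Finset (List (Fin N)) :=
  (Finset.univ : Finset (Fin k → Fin N)).map ⟨List.ofFn, List.ofFn_injective⟩

theorem mem_words {k : ℕ} {w : List (Fin N)} : w ∈ words N k ↔ w.length = k := by
  simp only [words, Finset.mem_map, Finset.mem_univ, true_and, Function.Embedding.coeFn_mk]
  constructor
  · rintro ⟨f, rfl⟩; simp
  · rintro rfl; exact ⟨w.get, List.ofFn_get w⟩

/-- The sum of `φ^t` over all words of length `k`. -/
def phiSum (S : Fin N → (Space n ≃ᵃ[ℝ] Space n)) (t : ℝ) (k : ℕ) : ℝ :=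
  ∑ w ∈ words N k, phi t (wordMap S w)

theorem phiSum_eq (t : ℝ) (k : ℕ) :
    phiSum S t k = ∑ w : Fin k → Fin N, phi t (wordMap S (List.ofFn w)) := by
  rw [phiSum, words, Finset.sum_map]
  rfl

theorem phiSum_nonneg (t : ℝ) (k : ℕ) : 0 ≤ phiSum S t k :=
  Finset.sum_nonneg fun _ _ => (phi_pos _ _).le

theorem phiSum_add_le (t : ℝ) (k l : ℕ) : phiSum S t (k + l) ≤ phiSum S t k * phiSum S t l := by
  classical
  have hsub : words N (k + l) ⊆ (words N k ×ˢ words N l).image fun p => p.1 ++ p.2 := by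
    intro w hw
    rw [mem_words] at hw
    refine Finset.mem_image.2 ⟨(w.take k, w.drop k), ?_, List.take_append_drop k w⟩
    simp only [Finset.mem_product, mem_words, List.length_take, List.length_drop]
    omega
  calc phiSum S t (k + l)
      ≤ ∑ w ∈ (words N k ×ˢ words N l).image (fun p => p.1 ++ p.2), phi t (wordMap S w) :=
        Finset.sum_le_sum_of_subset_of_nonneg hsub fun _ _ _ => (phi_pos _ _).le
    _ ≤ ∑ p ∈ words N k ×ˢ words N l, phi t (wordMap S (p.1 ++ p.2)) :=
        Finset.sum_image_le_of_nonneg fun _ _ => (phi_pos _ _).le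
    _ ≤ ∑ p ∈ words N k ×ˢ words N l, phi t (wordMap S p.1) * phi t (wordMap S p.2) := by
        refine Finset.sum_le_sum fun p _ => ?_
        rw [wordMap_append]
        exact phi_mul_le _ _ _
    _ = phiSum S t k * phiSum S t l := by
        rw [phiSum, phiSum, Finset.sum_mul_sum, Finset.sum_product]

/-- A common contraction ratio of the linear parts. -/
theorem exists_contraction_ratio (hS : ∀ i, IsContracting (S i)) :
    ∃ c : ℝ, 0 < c ∧ c < 1 ∧ ∀ i x, ‖(S i).linear x‖ ≤ c * ‖x‖ := by
  choose c hc0 hc1 hc using hS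
  have hlin : ∀ i x, ‖(S i).linear x‖ ≤ c i * ‖x‖ := by
    intro i x
    have h := hc i x 0
    have hv := (S i).toAffineMap.linearMap_vsub x 0
    rw [vsub_eq_sub, vsub_eq_sub, sub_zero] at hv
    rw [dist_eq_norm, dist_zero_right] at h
    exact (congrArg norm hv).trans_le h
  rcases isEmpty_or_nonempty (Fin N) with hN | hN
  · exact ⟨1 / 2, by norm_num, by norm_num, fun i => isEmptyElim i⟩
  · obtain ⟨i₀, hi₀⟩ := Finite.exists_max c
    exact ⟨c i₀, hc0 _, hc1 _, fun i x => (hlin i x).trans (by gcongr; exact hi₀ i)⟩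

theorem norm_linear_wordMap_le {c : ℝ} (hc0 : 0 < c)
    (hc : ∀ i x, ‖(S i).linear x‖ ≤ c * ‖x‖) (w : List (Fin N)) (x : Space n) :
    ‖(wordMap S w).linear x‖ ≤ c ^ w.length * ‖x‖ := by
  induction w with
  | nil => simp [wordMap_nil, AffineEquiv.one_def]
  | cons i w ih =>
    rw [wordMap_cons]
    calc ‖(S i).linear ((wordMap S w).linear x)‖ ≤ c * ‖(wordMap S w).linear x‖ := hc i _
      _ ≤ c * (c ^ w.length * ‖x‖) := by gcongr
      _ = _ := by rw [List.length_cons, pow_succ]; ring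

theorem singVal_wordMap_le {c : ℝ} (hc0 : 0 < c)
    (hc : ∀ i x, ‖(S i).linear x‖ ≤ c * ‖x‖) (w : List (Fin N)) {m : ℕ} (hm : m - 1 < n) :
    singVal m (wordMap S w) ≤ c ^ w.length :=
  singVal_le_of_norm_le _ (norm_linear_wordMap_le hc0 hc w) hm

theorem phiSum_le_rpow_mul (hn : 1 ≤ n) {c : ℝ} (hc0 : 0 < c)
    (hc : ∀ i x, ‖(S i).linear x‖ ≤ c * ‖x‖) {t t' : ℝ} (ht : 0 ≤ t) (htt : t ≤ t') (k : ℕ) :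
    phiSum S t' k ≤ (c ^ k) ^ (t' - t) * phiSum S t k := by
  rw [phiSum, phiSum, Finset.mul_sum]
  refine Finset.sum_le_sum fun w hw => ?_
  refine phi_le_rpow_mul_phi hn _ (fun m hm => ?_) ht htt
  have := singVal_wordMap_le hc0 hc w hm
  rwa [mem_words.1 hw] at this

theorem phiSum_zero (k : ℕ) : phiSum S 0 k = (N : ℝ) ^ k := by
  rw [phiSum_eq]
  simp [phi_of_nonpos]

theorem phiSum_lt_of_lt (hn : 1 ≤ n) (hN : 1 ≤ N) {c : ℝ} (hc0 : 0 < c) (hc1 : c < 1)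
    (hc : ∀ i x, ‖(S i).linear x‖ ≤ c * ‖x‖) {t t' : ℝ} (ht : 0 ≤ t) (htt : t < t') {k : ℕ}
    (hk : 1 ≤ k) : phiSum S t' k < phiSum S t k := by
  have hpos : 0 < phiSum S t k := by
    refine Finset.sum_pos (fun _ _ => phi_pos _ _) ⟨List.replicate k ⟨0, hN⟩, ?_⟩
    simp [mem_words]
  refine (phiSum_le_rpow_mul hn hc0 hc ht htt.le k).trans_lt ?_
  refine mul_lt_of_lt_one_left hpos (Real.rpow_lt_one (by positivity) ?_ (by linarith))
  exact pow_lt_one₀ hc0.le hc1 (by omega)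

theorem exists_phiSum_eq_one (hn : 1 ≤ n) (hN : 1 ≤ N) {c : ℝ} (hc0 : 0 < c) (hc1 : c < 1)
    (hc : ∀ i x, ‖(S i).linear x‖ ≤ c * ‖x‖) {k : ℕ} (hk : 1 ≤ k) :
    ∃ u : ℝ, 0 ≤ u ∧ phiSum S u k = 1 := by
  have hck : c ^ k < 1 := pow_lt_one₀ hc0.le hc1 (by omega)
  have hck0 : 0 < c ^ k := by positivity
  have hlim : Tendsto (fun t : ℝ => (c ^ k) ^ t * (N : ℝ) ^ k) atTop (𝓝 (0 * (N : ℝ) ^ k)) :=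
    (tendsto_rpow_atTop_of_base_lt_one _ (by linarith) hck).mul_const _
  rw [zero_mul] at hlim
  obtain ⟨T, hT1, hT0⟩ := ((hlim.eventually (gt_mem_nhds zero_lt_one)).and
    (eventually_ge_atTop 0)).exists
  have hT : phiSum S T k ≤ 1 := by
    have := phiSum_le_rpow_mul (S := S) hn hc0 hc le_rfl hT0 k
    rw [phiSum_zero, sub_zero] at this
    exact this.trans hT1.le
  have h0 : 1 ≤ phiSum S 0 k := by
    rw [phiSum_zero]; exact one_le_pow₀ (by exact_mod_cast hN)
  have hcont : Continuous fun t => phiSum S t k :=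
    continuous_finsetSum _ fun w _ => continuous_phi _
  obtain ⟨u, hu, h⟩ := intermediate_value_Icc' hT0 hcont.continuousOn ⟨hT, h0⟩
  exact ⟨u, hu.1, h⟩

/-- If the sum over the words of some length is less than `1`, then the sum over all words
converges. -/
theorem summable_phiSum {t : ℝ} {k : ℕ} (hk : 1 ≤ k) (h : phiSum S t k < 1) :
    Summable (phiSum S t) := by
  set q := phiSum S t k with hq
  have hq0 : 0 ≤ q := phiSum_nonneg _ _
  have hnn : ∀ l, 0 ≤ phiSum S t l := phiSum_nonneg t
  set B := ∑ l ∈ Finset.range k, phiSum S t l with hB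
  have hB0 : 0 ≤ B := Finset.sum_nonneg fun l _ => hnn l
  -- Submultiplicativity bounds the next partial sum by B + q times the present one, and B / (1 - q)
  -- is the fixed point of this recursion.
  have hσ : ∀ m : ℕ, ∑ l ∈ Finset.range (k * m), phiSum S t l ≤ B / (1 - q) := by
    intro m
    induction m with
    | zero => simpa using div_nonneg hB0 (by linarith)
    | succ m ih =>
      rw [Nat.mul_succ, Nat.add_comm, Finset.sum_range_add]
      have h1 : ∑ l ∈ Finset.range (k * m), phiSum S t (k + l) ≤
          q * ∑ l ∈ Finset.range (k * m), phiSum S t l := by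
        rw [Finset.mul_sum]
        exact Finset.sum_le_sum fun l _ => phiSum_add_le _ _ _
      have h2 : B / (1 - q) = B + q * (B / (1 - q)) := by
        have : 1 - q ≠ 0 := by linarith
        field_simp
        ring
      rw [h2]
      exact add_le_add le_rfl (h1.trans (mul_le_mul_of_nonneg_left ih hq0))
  refine summable_of_sum_range_le hnn (c := B / (1 - q)) fun L => ?_
  refine le_trans ?_ (hσ L)
  refine Finset.sum_le_sum_of_subset_of_nonneg ?_ fun l _ _ => hnn l
  exact Finset.range_subset_range.2 (Nat.le_mul_of_pos_left L hk)

/-- The affinity dimension exists. -/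
theorem exists_isAffinityDimension (hn : 1 ≤ n) (hN : 1 ≤ N) (hS : ∀ i, IsContracting (S i)) :
    ∃ s : ℝ, IsAffinityDimension S s := by
  obtain ⟨c, hc0, hc1, hc⟩ := exists_contraction_ratio hS
  have hex : ∀ k : ℕ, ∃ u : ℝ, 0 ≤ u ∧ (1 ≤ k → phiSum S u k = 1) := by
    intro k
    by_cases hk : 1 ≤ k
    · obtain ⟨u, h0, h1⟩ := exists_phiSum_eq_one hn hN hc0 hc1 hc hk
      exact ⟨u, h0, fun _ => h1⟩
    · exact ⟨0, le_rfl, fun h => absurd h hk⟩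
  choose u hu0 hu1 using hex
  -- The limit is the infimum: if a > u k for one k, the sums at exponent a are summable, hence tend
  -- to 0, which forces u l < a for all large l.
  set s := sInf (u '' Ici 1) with hs
  have hbdd : BddBelow (u '' Ici 1) := ⟨0, by rintro _ ⟨k, _, rfl⟩; exact hu0 k⟩
  refine ⟨s, u, fun k hk => ⟨hu0 k, by rw [← phiSum_eq]; exact hu1 k hk⟩, ?_⟩
  rw [tendsto_order]
  constructor
  · intro a ha
    filter_upwards [eventually_ge_atTop 1] with k hk
    exact ha.trans_le (csInf_le hbdd ⟨k, hk, rfl⟩)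
  · intro a ha
    obtain ⟨_, ⟨k, hk, rfl⟩, hka⟩ := exists_lt_of_csInf_lt (nonempty_Ici.image u) ha
    have h1 : phiSum S a k < 1 := by
      rw [← hu1 k hk]
      exact phiSum_lt_of_lt hn hN hc0 hc1 hc (hu0 k) hka hk
    have h2 := (summable_phiSum hk h1).tendsto_atTop_zero
    filter_upwards [h2.eventually (gt_mem_nhds zero_lt_one), eventually_ge_atTop 1] with l hl hl1
    by_contra! hle
    rcases hle.lt_or_eq with hlt | heq
    · have := phiSum_lt_of_lt hn hN hc0 hc1 hc ((hu0 k).trans hka.le) hlt hl1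
      rw [hu1 l hl1] at this
      linarith
    · rw [heq, hu1 l hl1] at hl
      exact lt_irrefl _ hl

theorem IsAffinityDimension.summable_phiSum (hn : 1 ≤ n) (hN : 1 ≤ N)
    (hS : ∀ i, IsContracting (S i)) {s t : ℝ} (hs : IsAffinityDimension S s) (hst : s < t) :
    Summable (phiSum S t) := by
  obtain ⟨c, hc0, hc1, hc⟩ := exists_contraction_ratio hS
  obtain ⟨u, hu, hlim⟩ := hs
  obtain ⟨k, hk, hk1⟩ := ((hlim.eventually (gt_mem_nhds hst)).and (eventually_ge_atTop 1)).exists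
  refine AffineIFS.summable_phiSum hk1 ?_
  rw [← (hu k hk1).2, ← phiSum_eq]
  exact phiSum_lt_of_lt hn hN hc0 hc1 hc (hu k hk1).1 hk hk1

theorem IsAffinityDimension.eventually_one_lt_phiSum (hn : 1 ≤ n) (hN : 1 ≤ N)
    (hS : ∀ i, IsContracting (S i)) {s t : ℝ} (hs : IsAffinityDimension S s) (ht : 0 ≤ t)
    (hts : t < s) : ∀ᶠ k in atTop, 1 < phiSum S t k := by
  obtain ⟨c, hc0, hc1, hc⟩ := exists_contraction_ratio hS
  obtain ⟨u, hu, hlim⟩ := hs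
  filter_upwards [hlim.eventually (lt_mem_nhds hts), eventually_ge_atTop 1] with k hk hk1
  rw [← (hu k hk1).2, ← phiSum_eq]
  exact phiSum_lt_of_lt hn hN hc0 hc1 hc ht hk hk1

end Words

/-! ### Covering numbers and volume -/

section CoveringNumbers

open MeasureTheory Metric Bornology

variable {n : ℕ}

theorem closedBall_subset_cube (y : Space n) (δ : ℝ) :
    closedBall y (δ / 2) ⊆ cube (y - WithLp.toLp 2 fun _ => δ / 2) δ := by
  intro x hx j
  rw [mem_closedBall, dist_eq_norm] at hx
  have h := (PiLp.norm_apply_le (x - y) j).trans hx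
  rw [PiLp.sub_apply, Real.norm_eq_abs, abs_le] at h
  simp only [PiLp.sub_apply]
  constructor <;> linarith [h.1, h.2]

theorem cube_subset_closedBall (a : Space n) {δ : ℝ} (hδ : 0 ≤ δ) :
    cube a δ ⊆ closedBall a (n * δ) := by
  intro x hx
  rw [mem_closedBall, dist_eq_norm, EuclideanSpace.norm_eq]
  refine Real.sqrt_le_iff.2 ⟨by positivity, ?_⟩
  have h : ∀ j : Fin n, ‖(x - a) j‖ ^ 2 ≤ δ ^ 2 := by
    intro j
    rw [PiLp.sub_apply, Real.norm_eq_abs, sq_abs]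
    have := hx j
    nlinarith [this.1, this.2]
  calc ∑ j, ‖(x - a) j‖ ^ 2 ≤ ∑ _j : Fin n, δ ^ 2 := Finset.sum_le_sum fun j _ => h j
    _ = n * δ ^ 2 := by simp
    _ ≤ (n * n) * δ ^ 2 := by
        gcongr
        exact_mod_cast Nat.le_mul_self n
    _ = _ := by ring

theorem cube_mono (a : Space n) {δ δ' : ℝ} (h : δ ≤ δ') : cube a δ ⊆ cube a δ' :=
  fun _ hx j => ⟨(hx j).1, (hx j).2.trans (by linarith)⟩

theorem coverNum_le_card {δ : ℝ} {F : Set (Space n)} {t : Finset (Space n)}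
    (h : F ⊆ ⋃ a ∈ t, cube a δ) : coverNum δ F ≤ t.card :=
  Nat.sInf_le ⟨t, rfl, h⟩

theorem coverNum_le_card_of_closedBall {δ : ℝ} {F : Set (Space n)} {t : Finset (Space n)}
    (h : F ⊆ ⋃ a ∈ t, closedBall a (δ / 2)) : coverNum δ F ≤ t.card := by
  classical
  refine (coverNum_le_card (t := t.image fun y => y - WithLp.toLp 2 fun _ => δ / 2) ?_).trans
    Finset.card_image_le
  rw [Finset.set_biUnion_finset_image]
  exact h.trans (iUnion₂_mono fun y _ => closedBall_subset_cube y δ)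

theorem exists_cover_card_eq {δ : ℝ} (hδ : 0 < δ) {F : Set (Space n)} (hF : IsBounded F) :
    ∃ t : Finset (Space n), t.card = coverNum δ F ∧ F ⊆ ⋃ a ∈ t, cube a δ := by
  classical
  refine Nat.sInf_mem (s := {k : ℕ | ∃ t : Finset (Space n), t.card = k ∧ F ⊆ ⋃ a ∈ t, cube a δ}) ?_
  obtain ⟨t, ht, hcov⟩ := Metric.totallyBounded_iff.1
    (Metric.isCompact_of_isClosed_isBounded isClosed_closure hF.closure).totallyBounded
    (δ / 2) (by positivity)
  refine ⟨_, ht.toFinset.image fun y => y - WithLp.toLp 2 fun _ => δ / 2, rfl, ?_⟩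
  rw [Finset.set_biUnion_finset_image]
  simp only [Set.Finite.mem_toFinset]
  exact subset_closure.trans (hcov.trans (iUnion₂_mono fun y _ =>
    ball_subset_closedBall.trans (closedBall_subset_cube y δ)))

theorem coverNum_mono {δ : ℝ} (hδ : 0 < δ) {E F : Set (Space n)} (hF : IsBounded F) (h : E ⊆ F) :
    coverNum δ E ≤ coverNum δ F := by
  obtain ⟨t, ht, hcov⟩ := exists_cover_card_eq hδ hF
  rw [← ht]
  exact coverNum_le_card (h.trans hcov)

theorem coverNum_anti {δ δ' : ℝ} (hδ : 0 < δ) (hδδ : δ ≤ δ') {F : Set (Space n)}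
    (hF : IsBounded F) : coverNum δ' F ≤ coverNum δ F := by
  obtain ⟨t, ht, hcov⟩ := exists_cover_card_eq hδ hF
  rw [← ht]
  exact coverNum_le_card (hcov.trans (iUnion₂_mono fun a _ => cube_mono a hδδ))

theorem coverNum_biUnion_le {ι : Type*} {δ : ℝ} (hδ : 0 < δ) (s : Finset ι)
    {E : ι → Set (Space n)} (hE : ∀ i ∈ s, IsBounded (E i)) :
    coverNum δ (⋃ i ∈ s, E i) ≤ ∑ i ∈ s, coverNum δ (E i) := by
  classical
  choose! t ht hcov using fun i hi => exists_cover_card_eq hδ (hE i hi)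
  refine (coverNum_le_card (t := s.biUnion t) ?_).trans ?_
  · rw [Finset.set_biUnion_biUnion]
    exact iUnion₂_mono hcov
  · exact Finset.card_biUnion_le.trans (Finset.sum_le_sum fun i hi => (ht i hi).le)

theorem one_le_coverNum {δ : ℝ} (hδ : 0 < δ) {F : Set (Space n)} (hF : IsBounded F)
    (hne : F.Nonempty) : 1 ≤ coverNum δ F := by
  obtain ⟨t, ht, hcov⟩ := exists_cover_card_eq hδ hF
  obtain ⟨x, hx⟩ := hne
  obtain ⟨a, ha, _⟩ := mem_iUnion₂.1 (hcov hx)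
  rw [← ht]
  exact Finset.card_pos.2 ⟨a, ha⟩

/-- The volume of the unit ball. -/
def ballVol (n : ℕ) : ℝ := volume.real (ball (0 : Space n) 1)

theorem ballVol_pos (n : ℕ) : 0 < ballVol n :=
  ENNReal.toReal_pos (measure_ball_pos _ _ zero_lt_one).ne' measure_ball_lt_top.ne

theorem volume_real_closedBall (x : Space n) {r : ℝ} (hr : 0 ≤ r) :
    volume.real (closedBall x r) = r ^ n * ballVol n := by
  have := Measure.addHaar_real_closedBall (volume : Measure (Space n)) x hr
  rwa [finrank_euclideanSpace_fin] at this

theorem volume_real_ball (x : Space n) {r : ℝ} (hr : 0 < r) :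
    volume.real (ball x r) = r ^ n * ballVol n := by
  have := Measure.addHaar_ball_of_pos (volume : Measure (Space n)) x hr
  rw [finrank_euclideanSpace_fin] at this
  rw [measureReal_def, this, ENNReal.toReal_mul, ENNReal.toReal_ofReal (by positivity)]
  rfl

/-- Disjoint balls of equal radius in a set of finite volume. -/
theorem card_mul_le_of_pairwiseDisjoint_ball {ι : Type*} (s : Finset ι) (x : ι → Space n) {r : ℝ}
    (hr : 0 < r) (hdisj : (s : Set ι).PairwiseDisjoint fun i => ball (x i) r) {V : Set (Space n)}
    (hV : volume V ≠ ⊤) (hsub : ∀ i ∈ s, ball (x i) r ⊆ V) :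
    s.card * (r ^ n * ballVol n) ≤ volume.real V := by
  have h := measureReal_biUnion_finset (μ := volume) hdisj (fun i _ => measurableSet_ball)
    (fun i _ => measure_ball_lt_top.ne)
  simp only [volume_real_ball _ hr, Finset.sum_const, nsmul_eq_mul] at h
  rw [← h]
  exact measureReal_mono (iUnion₂_subset hsub) hV

/-- The covering number is bounded by the volume of a neighbourhood. -/
theorem coverNum_mul_le_volume {δ : ℝ} (hδ : 0 < δ) {F V : Set (Space n)} (hV : volume V ≠ ⊤)
    (hsub : ∀ x ∈ F, ball x (δ / 4) ⊆ V) :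
    coverNum δ F * ((δ / 4) ^ n * ballVol n) ≤ volume.real V := by
  classical
  by_contra! hlt
  have hb : 0 < (δ / 4) ^ n * ballVol n := mul_pos (by positivity) (ballVol_pos n)
  -- If the bound failed, volume would keep every δ/2-separated subset of F smaller than the
  -- covering number. Its δ/2-balls then cannot cover F, so it can be enlarged, and separated sets
  -- of every size appear.
  have hsep : ∀ k : ℕ, ∃ A : Finset (Space n), A.card = k ∧ (A : Set (Space n)) ⊆ F ∧
      (A : Set (Space n)).Pairwise fun x y => δ / 2 < dist x y := by
    intro k
    induction k with
    | zero => exact ⟨∅, rfl, by simp, by simp⟩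
    | succ k ih =>
      obtain ⟨A, hA, hAF, hAs⟩ := ih
      have hcard : (A.card : ℝ) < coverNum δ F := by
        have h1 := card_mul_le_of_pairwiseDisjoint_ball A id (r := δ / 4) (by positivity)
          (fun x hx y hy hxy => ball_disjoint_ball (by
            have := hAs hx hy hxy
            simp only [id]; linarith)) hV (fun x hx => hsub x (hAF hx))
        exact lt_of_mul_lt_mul_right (h1.trans_lt hlt) hb.le
      have hnc : ¬ F ⊆ ⋃ a ∈ A, closedBall a (δ / 2) := by
        intro hcov
        have := coverNum_le_card_of_closedBall hcov
        exact absurd hcard (not_lt.2 (by exact_mod_cast this))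
      obtain ⟨x, hx, hxA⟩ := not_subset.1 hnc
      have hxA' : ∀ a ∈ A, δ / 2 < dist x a := by simpa using hxA
      have hxn : x ∉ A := fun h => by
        have := hxA' x h
        rw [dist_self] at this
        linarith
      refine ⟨insert x A, by rw [Finset.card_insert_of_notMem hxn, hA], ?_, ?_⟩
      · rw [Finset.coe_insert]
        exact insert_subset hx hAF
      · rw [Finset.coe_insert, Set.pairwise_insert]
        exact ⟨hAs, fun a ha _ => ⟨hxA' a ha, by rw [dist_comm]; exact hxA' a ha⟩⟩
  obtain ⟨A, hA, hAF, hAs⟩ := hsep (coverNum δ F)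
  have h1 := card_mul_le_of_pairwiseDisjoint_ball A id (r := δ / 4) (by positivity)
    (fun x hx y hy hxy => ball_disjoint_ball (by
      have := hAs hx hy hxy
      simp only [id]; linarith)) hV (fun x hx => hsub x (hAF hx))
  rw [hA] at h1
  linarith

theorem volume_le_coverNum_mul {δ : ℝ} (hδ : 0 < δ) {F : Set (Space n)} (hF : IsBounded F) :
    volume.real F ≤ coverNum δ F * ((n * δ) ^ n * ballVol n) := by
  obtain ⟨t, ht, hcov⟩ := exists_cover_card_eq hδ hF
  have hsub : F ⊆ ⋃ a ∈ t, closedBall a (n * δ) :=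
    hcov.trans (iUnion₂_mono fun a _ => cube_subset_closedBall a hδ.le)
  have hfin : volume (⋃ a ∈ t, closedBall a (n * δ)) ≠ ⊤ :=
    ((measure_biUnion_finset_le t _).trans_lt
      (ENNReal.sum_lt_top.2 fun a _ => measure_closedBall_lt_top)).ne
  refine (measureReal_mono hsub hfin).trans ((measureReal_biUnion_finset_le t _).trans_eq ?_)
  simp only [volume_real_closedBall _ (show 0 ≤ n * δ by positivity), Finset.sum_const, ht,
    nsmul_eq_mul]

theorem affine_apply_sub (f : Space n ≃ᵃ[ℝ] Space n) (x y : Space n) :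
    f x - f y = f.linear (x - y) :=
  (f.toAffineMap.linearMap_vsub x y).symm

theorem volume_real_image (f : Space n ≃ᵃ[ℝ] Space n) (s : Set (Space n)) :
    volume.real (f '' s) = absDet f * volume.real s := by
  have h1 : f '' s = (fun y => y + f 0) '' ((f.linear : Space n →ₗ[ℝ] Space n) '' s) := by
    rw [image_image]
    refine image_congr fun x _ => ?_
    have := affine_apply_sub f x 0
    rw [sub_zero] at this
    change f x = f.linear x + f 0
    rw [← this]; abel
  rw [measureReal_def, h1, image_add_right, measure_preimage_add_right,
    Measure.addHaar_image_linearMap, ENNReal.toReal_mul, ENNReal.toReal_ofReal (abs_nonneg _)]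
  rfl

theorem ball_subset_image_ball (hn : 1 ≤ n) (f : Space n ≃ᵃ[ℝ] Space n) (x : Space n) (r : ℝ) :
    ball (f x) r ⊆ f '' ball x (r / singVal n f) := by
  intro y hy
  have hp := singVal_pos f (m := n) (by omega)
  refine ⟨f.symm y, ?_, f.apply_symm_apply y⟩
  have h := singVal_mul_norm_le f (f.symm y - x)
  rw [← affine_apply_sub, f.apply_symm_apply] at h
  rw [mem_ball, dist_eq_norm] at hy ⊢
  rw [lt_div_iff₀ hp, mul_comm]
  exact h.trans_lt hy

theorem isBounded_image (f : Space n ≃ᵃ[ℝ] Space n) {E : Set (Space n)} (hE : IsBounded E) :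
    IsBounded (f '' E) :=
  ((Metric.isCompact_of_isClosed_isBounded isClosed_closure hE.closure).image
    f.toAffineMap.continuous_of_finiteDimensional).isBounded.subset (image_mono subset_closure)

/-- The δ/4-neighbourhood of the image lies in the image of the ball enlarged by (δ/4) / α_n, whose
volume is explicit. -/
theorem coverNum_image_mul_le (hn : 1 ≤ n) (f : Space n ≃ᵃ[ℝ] Space n) {δ ρ : ℝ} (hδ : 0 < δ)
    (hρ : 0 ≤ ρ) {E : Set (Space n)} {y : Space n} (hE : E ⊆ closedBall y ρ) :
    coverNum δ (f '' E) * (δ / 4) ^ n ≤ absDet f * (ρ + δ / 4 / singVal n f) ^ n := by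
  have hp := singVal_pos f (m := n) (by omega)
  have hR : 0 ≤ ρ + δ / 4 / singVal n f := by positivity
  have hV : volume (f '' closedBall y (ρ + δ / 4 / singVal n f)) ≠ ⊤ :=
    (isBounded_image f isBounded_closedBall).measure_lt_top.ne
  have h := coverNum_mul_le_volume hδ (F := f '' E) hV (by
    rintro _ ⟨x, hx, rfl⟩
    refine (ball_subset_image_ball hn f x _).trans (image_mono ?_)
    refine ball_subset_closedBall.trans (closedBall_subset_closedBall' ?_)
    have := hE hx
    rw [mem_closedBall] at this
    linarith)
  rw [volume_real_image, volume_real_closedBall _ hR, ← mul_assoc, ← mul_assoc] at h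
  exact le_of_mul_le_mul_right h (ballVol_pos n)

/-- At scale δ / α_n, enlarging a cube by the same scale costs only a constant factor in volume. So
the image of each cube is covered by about |det| / α_n^n cubes of side δ. -/
theorem coverNum_image_le_mul_coverNum (hn : 1 ≤ n) (f : Space n ≃ᵃ[ℝ] Space n) {δ : ℝ}
    (hδ : 0 < δ) {E : Set (Space n)} (hE : IsBounded E) :
    (coverNum δ (f '' E) : ℝ) ≤ coverNum (δ / singVal n f) E *
      (absDet f * (4 * (n + 1) / singVal n f) ^ n) := by
  have hp := singVal_pos f (m := n) (by omega)
  set η := δ / singVal n f with hη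
  have hη0 : 0 < η := by positivity
  obtain ⟨t, ht, hcov⟩ := exists_cover_card_eq hη0 hE
  have hcb : ∀ a : Space n, IsBounded (cube a η) := fun a =>
    isBounded_closedBall.subset (cube_subset_closedBall a hη0.le)
  have hcube : ∀ a : Space n, (coverNum δ (f '' cube a η) : ℝ) ≤
      absDet f * (4 * (n + 1) / singVal n f) ^ n := by
    intro a
    have h := coverNum_image_mul_le hn f hδ (by positivity) (cube_subset_closedBall a hη0.le)
    have h2 : absDet f * (n * η + δ / 4 / singVal n f) ^ n ≤
        absDet f * (4 * (n + 1) / singVal n f) ^ n * (δ / 4) ^ n := by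
      rw [mul_assoc, ← mul_pow]
      refine mul_le_mul_of_nonneg_left (pow_le_pow_left₀ (by positivity) ?_ n) (absDet_pos f).le
      rw [show δ / 4 / singVal n f = η / 4 by rw [hη]; ring,
        show 4 * ((n : ℝ) + 1) / singVal n f * (δ / 4) = (n + 1) * η by rw [hη]; ring]
      nlinarith
    exact le_of_mul_le_mul_right (h.trans h2) (by positivity)
  have h1 : coverNum δ (f '' E) ≤ ∑ a ∈ t, coverNum δ (f '' cube a η) := by
    refine le_trans (coverNum_mono hδ ?_ ?_)
      (coverNum_biUnion_le hδ t fun a _ => isBounded_image f (hcb a))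
    · exact (isBounded_biUnion_finset t).2 fun a _ => isBounded_image f (hcb a)
    · refine (image_mono hcov).trans ?_
      rw [image_iUnion₂]
  calc (coverNum δ (f '' E) : ℝ) ≤ ∑ a ∈ t, (coverNum δ (f '' cube a η) : ℝ) := by
        exact_mod_cast h1
    _ ≤ ∑ _a ∈ t, absDet f * (4 * (n + 1) / singVal n f) ^ n :=
        Finset.sum_le_sum fun a _ => hcube a
    _ = _ := by rw [Finset.sum_const, nsmul_eq_mul, ht]

end CoveringNumbers

/-! ### Stopped words -/

section Stopping

variable {n N : ℕ} {S : Fin N → (Space n ≃ᵃ[ℝ] Space n)}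

theorem singVal_wordMap_append_le (hn : 1 ≤ n) {c : ℝ} (hc0 : 0 < c) (hc1 : c < 1)
    (hc : ∀ i x, ‖(S i).linear x‖ ≤ c * ‖x‖) (v w : List (Fin N)) :
    singVal n (wordMap S (v ++ w)) ≤ singVal n (wordMap S v) := by
  rw [wordMap_append]
  refine (singVal_mul_le_of_norm_le hn _ _ (norm_linear_wordMap_le hc0 hc w)).trans ?_
  exact mul_le_of_le_one_right (singVal_nonneg _ _) (pow_le_one₀ hc0.le hc1.le)

/-- A common lower bound for the smallest singular values. -/
theorem exists_le_singVal (hn : 1 ≤ n) (S : Fin N → (Space n ≃ᵃ[ℝ] Space n)) :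
    ∃ a : ℝ, 0 < a ∧ a ≤ 1 ∧ ∀ i, a ≤ singVal n (S i) := by
  rcases isEmpty_or_nonempty (Fin N) with hN | hN
  · exact ⟨1, one_pos, le_rfl, fun i => isEmptyElim i⟩
  · obtain ⟨i₀, hi₀⟩ := Finite.exists_min fun i => singVal n (S i)
    exact ⟨min 1 (singVal n (S i₀)), lt_min one_pos (singVal_pos _ (by omega)), min_le_left _ _,
      fun i => (min_le_right _ _).trans (hi₀ i)⟩

/-- The last letter shrinks α_n by a factor no smaller than a, so α_n is comparable to δ on stopped
words. -/
theorem mul_le_singVal_of_mem_stopping (hn : 1 ≤ n) {a : ℝ} (ha0 : 0 ≤ a)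
    (ha : ∀ i, a ≤ singVal n (S i)) {δ : ℝ} {w : List (Fin N)} (hw : w ∈ stopping S n δ) :
    a * δ ≤ singVal n (wordMap S w) := by
  obtain ⟨hne, _, h⟩ := hw
  conv_rhs => rw [← List.dropLast_append_getLast hne, wordMap_append, wordMap_singleton]
  refine le_trans ?_ (singVal_mul_singVal_le hn _ _)
  rw [mul_comm]
  exact mul_le_mul h (ha _) ha0 (singVal_nonneg _ _)

theorem exists_length_bound (hn : 1 ≤ n) {c : ℝ} (hc0 : 0 < c) (hc1 : c < 1)
    (hc : ∀ i x, ‖(S i).linear x‖ ≤ c * ‖x‖) {δ : ℝ} (hδ : 0 < δ) :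
    ∃ L : ℕ, 1 ≤ L ∧ (∀ w, δ ≤ singVal n (wordMap S w) → w.length < L) ∧
      ∀ w ∈ stopping S n δ, w.length ≤ L := by
  obtain ⟨L, hL⟩ := exists_pow_lt_of_lt_one hδ hc1
  have h1 : ∀ w, δ ≤ singVal n (wordMap S w) → w.length < L := by
    intro w hw
    by_contra! hle
    have h2 := hw.trans (singVal_wordMap_le hc0 hc w (m := n) (by omega))
    have h3 := pow_le_pow_of_le_one hc0.le hc1.le hle
    linarith
  refine ⟨L + 1, by omega, fun w hw => (h1 w hw).trans (by omega), fun w hw => ?_⟩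
  have := h1 _ hw.2.2
  rw [List.length_dropLast] at this
  omega

theorem finite_stopping (hn : 1 ≤ n) (hS : ∀ i, IsContracting (S i)) {δ : ℝ} (hδ : 0 < δ) :
    (stopping S n δ).Finite := by
  obtain ⟨c, hc0, hc1, hc⟩ := exists_contraction_ratio hS
  obtain ⟨L, _, _, hL⟩ := exists_length_bound hn hc0 hc1 hc hδ
  exact (List.finite_length_le (Fin N) L).subset hL

theorem finite_le_singVal (hn : 1 ≤ n) (hS : ∀ i, IsContracting (S i)) {δ : ℝ} (hδ : 0 < δ) :
    {w | δ ≤ singVal n (wordMap S w)}.Finite := by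
  obtain ⟨c, hc0, hc1, hc⟩ := exists_contraction_ratio hS
  obtain ⟨L, _, hL, _⟩ := exists_length_bound hn hc0 hc1 hc hδ
  exact (List.finite_length_lt (Fin N) L).subset hL

/-- Take the first prefix at which α_n falls below δ; it is non-empty since the identity has α_n = 1
≥ δ. -/
theorem exists_prefix_mem_stopping (hn : 1 ≤ n) {δ : ℝ} (hδ : δ ≤ 1) (w : List (Fin N))
    (hw : singVal n (wordMap S w) < δ) : ∃ v u, v ∈ stopping S n δ ∧ w = v ++ u := by
  induction w using List.reverseRecOn with
  | nil =>
    rw [wordMap_nil, singVal_one_eq_one hn] at hw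
    linarith
  | append_singleton l i ih =>
    by_cases h : singVal n (wordMap S l) < δ
    · obtain ⟨v, u, hv, rfl⟩ := ih h
      exact ⟨v, u ++ [i], hv, by rw [List.append_assoc]⟩
    · refine ⟨l ++ [i], [], ⟨by simp, hw, ?_⟩, by simp⟩
      rw [List.dropLast_concat]
      exact not_lt.1 h

/-- Since α_n does not increase along extensions, a proper extension of v would have been stopped
earlier. Stopped words thus form an antichain, as `disjoint_image_wordMap` needs. -/
theorem eq_of_prefix_of_mem_stopping (hn : 1 ≤ n) (hS : ∀ i, IsContracting (S i)) {δ : ℝ}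
    {v w : List (Fin N)} (hv : v ∈ stopping S n δ) (hw : w ∈ stopping S n δ) (h : v <+: w) :
    v = w := by
  obtain ⟨c, hc0, hc1, hc⟩ := exists_contraction_ratio hS
  obtain ⟨u, rfl⟩ := h
  by_cases hu : u = []
  · simp [hu]
  · have h1 := hw.2.2
    rw [List.dropLast_append_of_ne_nil hu] at h1
    exact absurd (h1.trans (singVal_wordMap_append_le hn hc0 hc1 hc v u.dropLast))
      (not_le.2 hv.2.1)

theorem image_wordMap_subset {U : Set (Space n)} (hU : ∀ i, S i '' U ⊆ U) (w : List (Fin N)) :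
    wordMap S w '' U ⊆ U := by
  induction w with
  | nil => rw [wordMap_nil]; exact (image_id U).subset
  | cons i w ih =>
    rw [wordMap_cons, AffineEquiv.coe_mul, image_comp]
    exact (image_mono ih).trans (hU i)

/-- Cancel the common prefix by injectivity; at the first differing letter the open set condition
separates the images. -/
theorem disjoint_image_wordMap {U : Set (Space n)} (hU : ∀ i, S i '' U ⊆ U)
    (hd : ∀ i j, i ≠ j → Disjoint (S i '' U) (S j '' U)) (v w : List (Fin N))
    (hvw : ¬ v <+: w) (hwv : ¬ w <+: v) : Disjoint (wordMap S v '' U) (wordMap S w '' U) := by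
  induction v generalizing w with
  | nil => exact absurd List.nil_prefix hvw
  | cons i v ih =>
    cases w with
    | nil => exact absurd List.nil_prefix hwv
    | cons j w =>
      rw [wordMap_cons, wordMap_cons, AffineEquiv.coe_mul, AffineEquiv.coe_mul, image_comp,
        image_comp]
      by_cases hij : i = j
      · subst hij
        rw [disjoint_image_iff (S i).injective]
        exact ih w (fun h => hvw (by simpa using h)) (fun h => hwv (by simpa using h))
      · exact (hd i j hij).mono (image_mono (image_wordMap_subset hU v))
          (image_mono (image_wordMap_subset hU w))

theorem sum_phi_le_tsum {t : ℝ} (hs : Summable (phiSum S t)) (J : Finset (List (Fin N))) :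
    ∑ w ∈ J, phi t (wordMap S w) ≤ ∑' k, phiSum S t k := by
  classical
  have hsub : J ⊆ (J.image List.length).biUnion (words N) := by
    intro w hw
    exact Finset.mem_biUnion.2 ⟨w.length, Finset.mem_image_of_mem _ hw, mem_words.2 rfl⟩
  calc ∑ w ∈ J, phi t (wordMap S w)
      ≤ ∑ w ∈ (J.image List.length).biUnion (words N), phi t (wordMap S w) :=
        Finset.sum_le_sum_of_subset_of_nonneg hsub fun _ _ _ => (phi_pos _ _).le
    _ = ∑ k ∈ J.image List.length, phiSum S t k := by
        refine Finset.sum_biUnion fun k _ l _ hkl => Finset.disjoint_left.2 fun w hw hw' => hkl ?_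
        rw [← mem_words.1 hw, mem_words.1 hw']
    _ ≤ _ := hs.sum_le_tsum _ fun _ _ => phiSum_nonneg _ _

/-- Splitting off the stopped prefix of each long word. -/
theorem phiSum_le_sum_stopping (t : ℝ) {I : Finset (List (Fin N))} {k : ℕ}
    (hI : ∀ w ∈ words N k, ∃ v u, v ∈ I ∧ w = v ++ u) :
    phiSum S t k ≤ ∑ v ∈ I, phi t (wordMap S v) * phiSum S t (k - v.length) := by
  classical
  have hsub : words N k ⊆ (I.sigma fun v => words N (k - v.length)).image
      fun p => p.1 ++ p.2 := by
    intro w hw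
    obtain ⟨v, u, hv, rfl⟩ := hI w hw
    refine Finset.mem_image.2 ⟨⟨v, u⟩, Finset.mem_sigma.2 ⟨hv, ?_⟩, rfl⟩
    rw [mem_words] at hw ⊢
    rw [← hw, List.length_append]
    exact (Nat.add_sub_cancel_left _ _).symm
  calc phiSum S t k
      ≤ ∑ w ∈ (I.sigma fun v => words N (k - v.length)).image (fun p => p.1 ++ p.2),
          phi t (wordMap S w) :=
        Finset.sum_le_sum_of_subset_of_nonneg hsub fun _ _ _ => (phi_pos _ _).le
    _ ≤ ∑ p ∈ I.sigma fun v => words N (k - v.length), phi t (wordMap S (p.1 ++ p.2)) :=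
        Finset.sum_image_le_of_nonneg fun _ _ => (phi_pos _ _).le
    _ = ∑ v ∈ I, ∑ w ∈ words N (k - v.length), phi t (wordMap S (v ++ w)) := Finset.sum_sigma _ _ _
    _ ≤ _ := by
        refine Finset.sum_le_sum fun v _ => ?_
        rw [phiSum, Finset.mul_sum]
        refine Finset.sum_le_sum fun w _ => ?_
        rw [wordMap_append]
        exact phi_mul_le _ _ _

/-- Below the affinity dimension, the sums of the singular value function over stopped words are
at least `1`. -/
theorem one_le_sum_stopping (hn : 1 ≤ n) (hS : ∀ i, IsContracting (S i)) {t : ℝ}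
    (ht : ∀ᶠ k in atTop, 1 < phiSum S t k) {δ : ℝ} (hδ0 : 0 < δ) (hδ1 : δ ≤ 1)
    {I : Finset (List (Fin N))} (hI : ∀ w, w ∈ I ↔ w ∈ stopping S n δ) :
    1 ≤ ∑ w ∈ I, phi t (wordMap S w) := by
  obtain ⟨c, hc0, hc1, hc⟩ := exists_contraction_ratio hS
  obtain ⟨L, hL1, hLσ, hLI⟩ := exists_length_bound hn hc0 hc1 hc hδ0
  by_contra! hlt
  set q := ∑ w ∈ I, phi t (wordMap S w) with hq
  have hq0 : 0 ≤ q := Finset.sum_nonneg fun _ _ => (phi_pos _ _).le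
  set M := ∑ l ∈ Finset.range L, phiSum S t l with hM
  have hM0 : 0 ≤ M := Finset.sum_nonneg fun _ _ => phiSum_nonneg _ _
  -- Stopped words have between 1 and L letters, so splitting one off gains a factor q and shortens
  -- the word by at most L; M handles lengths below L. If q < 1, the sums would tend to 0 along
  -- multiples of L.
  have key : ∀ k, phiSum S t k ≤ M * q ^ (k / L) := by
    intro k
    induction k using Nat.strong_induction_on with
    | _ k ih =>
      rcases lt_or_ge k L with hk | hk
      · rw [Nat.div_eq_of_lt hk, pow_zero, mul_one]
        exact Finset.single_le_sum (f := phiSum S t) (fun _ _ => phiSum_nonneg _ _)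
          (Finset.mem_range.2 hk)
      · have h1 := phiSum_le_sum_stopping (S := S) t (I := I) (k := k) (by
          intro w hw
          obtain ⟨v, u, hv, h⟩ := exists_prefix_mem_stopping (S := S) hn hδ1 w (by
            by_contra! h
            have := hLσ w h
            rw [mem_words.1 hw] at this
            omega)
          exact ⟨v, u, (hI v).2 hv, h⟩)
        have hkL : k / L = (k - L) / L + 1 := by
          rw [← Nat.add_div_right _ (by omega), Nat.sub_add_cancel hk]
        calc phiSum S t k ≤ ∑ v ∈ I, phi t (wordMap S v) * phiSum S t (k - v.length) := h1
          _ ≤ ∑ v ∈ I, phi t (wordMap S v) * (M * q ^ ((k - L) / L)) := by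
              refine Finset.sum_le_sum fun v hv => mul_le_mul_of_nonneg_left ?_ (phi_pos _ _).le
              have hv' := (hI v).1 hv
              have hlen := hLI v hv'
              have hpos := List.length_pos_iff.2 hv'.1
              refine (ih _ (by omega)).trans (mul_le_mul_of_nonneg_left ?_ hM0)
              exact pow_le_pow_of_le_one hq0 hlt.le (Nat.div_le_div_right (by omega))
          _ = M * q ^ (k / L) := by
              rw [← Finset.sum_mul, ← hq, hkL, pow_succ]; ring
  have hlim : Tendsto (fun m : ℕ => M * q ^ m) atTop (𝓝 (M * 0)) :=
    (tendsto_pow_atTop_nhds_zero_of_lt_one hq0 hlt).const_mul M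
  rw [mul_zero] at hlim
  have hsub : Tendsto (fun m : ℕ => L * m) atTop atTop :=
    tendsto_id.const_mul_atTop' (by omega)
  obtain ⟨m, h1, h2⟩ := ((hlim.eventually (gt_mem_nhds zero_lt_one)).and
    (hsub.eventually ht)).exists
  have h3 := key (L * m)
  rw [Nat.mul_div_cancel_left m (by omega)] at h3
  linarith

end Stopping

/-! ### Box dimensions from bounds on covering numbers -/

section BoxDimensions

open Bornology

variable {n : ℕ}

theorem eventually_mem_Ioo_zero_one : ∀ᶠ δ : ℝ in 𝓝[>] 0, 0 < δ ∧ δ < 1 := by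
  filter_upwards [Ioo_mem_nhdsGT (zero_lt_one (α := ℝ))] with δ hδ using hδ

theorem lowerBoxDim_le_upperBoxDim (F : Set (Space n)) : lowerBoxDim F ≤ upperBoxDim F :=
  liminf_le_limsup

theorem log_coverNum_div_le {δ : ℝ} (hδ0 : 0 < δ) (hδ1 : δ < 1) {E F : Set (Space n)}
    (hF : IsBounded F) (hE : E.Nonempty) (h : E ⊆ F) :
    Real.log (coverNum δ E) / -Real.log δ ≤ Real.log (coverNum δ F) / -Real.log δ := by
  have h1 := one_le_coverNum hδ0 (hF.subset h) hE
  have h2 := coverNum_mono hδ0 hF h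
  have h3 := Real.log_neg hδ0 hδ1
  refine div_le_div_of_nonneg_right (Real.log_le_log ?_ (by exact_mod_cast h2)) (by linarith)
  exact_mod_cast h1

theorem upperBoxDim_mono {E F : Set (Space n)} (hF : IsBounded F) (hE : E.Nonempty) (h : E ⊆ F) :
    upperBoxDim E ≤ upperBoxDim F := by
  refine limsup_le_limsup ?_
  filter_upwards [eventually_mem_Ioo_zero_one] with δ hδ
  exact EReal.coe_le_coe_iff.2 (log_coverNum_div_le hδ.1 hδ.2 hF hE h)

theorem lowerBoxDim_mono {E F : Set (Space n)} (hF : IsBounded F) (hE : E.Nonempty) (h : E ⊆ F) :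
    lowerBoxDim E ≤ lowerBoxDim F := by
  refine liminf_le_liminf ?_
  filter_upwards [eventually_mem_Ioo_zero_one] with δ hδ
  exact EReal.coe_le_coe_iff.2 (log_coverNum_div_le hδ.1 hδ.2 hF hE h)

theorem tendsto_log_mul_rpow_div (K t : ℝ) (hK : 0 < K) :
    Tendsto (fun δ : ℝ => ((Real.log (K * δ ^ (-t)) / -Real.log δ : ℝ) : EReal)) (𝓝[>] 0)
      (𝓝 (t : EReal)) := by
  refine (continuous_coe_real_ereal.tendsto t).comp ?_
  have h1 : Tendsto (fun δ : ℝ => Real.log K / -Real.log δ + t) (𝓝[>] 0) (𝓝 (0 + t)) := by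
    refine Tendsto.add ?_ tendsto_const_nhds
    exact tendsto_const_nhds.div_atTop (tendsto_neg_atBot_atTop.comp Real.tendsto_log_nhdsGT_zero)
  rw [zero_add] at h1
  refine h1.congr' ?_
  filter_upwards [eventually_mem_Ioo_zero_one] with δ hδ
  have h3 := (Real.log_neg hδ.1 hδ.2).ne
  rw [Real.log_mul hK.ne' (Real.rpow_pos_of_pos hδ.1 _).ne', Real.log_rpow hδ.1]
  field_simp
  ring

theorem upperBoxDim_le_of_coverNum_le {F : Set (Space n)} (hF : IsBounded F) (hne : F.Nonempty)
    {K t : ℝ} (hK : 0 < K) (h : ∀ δ : ℝ, 0 < δ → δ ≤ 1 → (coverNum δ F : ℝ) ≤ K * δ ^ (-t)) :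
    upperBoxDim F ≤ t := by
  rw [← (tendsto_log_mul_rpow_div K t hK).limsup_eq]
  refine limsup_le_limsup ?_
  filter_upwards [eventually_mem_Ioo_zero_one] with δ hδ
  have h1 := one_le_coverNum hδ.1 hF hne
  have h3 := Real.log_neg hδ.1 hδ.2
  refine EReal.coe_le_coe_iff.2 (div_le_div_of_nonneg_right (Real.log_le_log ?_ ?_) (by linarith))
  · exact_mod_cast h1
  · exact h δ hδ.1 hδ.2.le

theorem le_lowerBoxDim_of_le_coverNum {F : Set (Space n)} {K t : ℝ} (hK : 0 < K)
    (h : ∀ δ : ℝ, 0 < δ → δ ≤ 1 → K * δ ^ (-t) ≤ (coverNum δ F : ℝ)) :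
    (t : EReal) ≤ lowerBoxDim F := by
  rw [← (tendsto_log_mul_rpow_div K t hK).liminf_eq]
  refine liminf_le_liminf ?_
  filter_upwards [eventually_mem_Ioo_zero_one] with δ hδ
  have h3 := Real.log_neg hδ.1 hδ.2
  exact EReal.coe_le_coe_iff.2 (div_le_div_of_nonneg_right
    (Real.log_le_log (mul_pos hK (Real.rpow_pos_of_pos hδ.1 _)) (h δ hδ.1 hδ.2.le)) (by linarith))

theorem exists_coverNum_le_of_upperBoxDim_lt {F : Set (Space n)} (hF : IsBounded F) {t : ℝ}
    (ht : 0 ≤ t) (h : upperBoxDim F < t) :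
    ∃ K : ℝ, 0 < K ∧ ∀ δ : ℝ, 0 < δ → δ ≤ 1 → (coverNum δ F : ℝ) ≤ K * δ ^ (-t) := by
  have hev := (eventually_lt_of_limsup_lt h).and eventually_mem_Ioo_zero_one
  obtain ⟨ε, hε, hsub⟩ := mem_nhdsGT_iff_exists_Ioo_subset.1 hev
  have hε : 0 < ε := hε
  -- The 1 serves δ < ε, where the limsup bound applies; the other term serves δ ≥ ε by monotonicity
  -- in δ.
  refine ⟨1 + coverNum (ε / 2) F, by positivity, fun δ hδ0 hδ1 => ?_⟩
  have hpow : 1 ≤ δ ^ (-t) := Real.one_le_rpow_of_pos_of_le_one_of_nonpos hδ0 hδ1 (by linarith)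
  rcases lt_or_ge δ ε with hlt | hge
  · obtain ⟨h1, h2⟩ := hsub ⟨hδ0, hlt⟩
    have h3 := Real.log_neg hδ0 h2.2
    have h4 : (coverNum δ F : ℝ) ≤ δ ^ (-t) := by
      rcases Nat.eq_zero_or_pos (coverNum δ F) with h0 | h0
      · rw [h0]; push_cast; linarith
      · have h5 := EReal.coe_lt_coe_iff.1 h1
        rw [div_lt_iff₀ (by linarith)] at h5
        refine (Real.log_le_log_iff (by exact_mod_cast h0) (by linarith)).1 ?_
        rw [Real.log_rpow hδ0]
        linarith
    refine h4.trans (le_mul_of_one_le_left (by linarith) ?_)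
    have : (0 : ℝ) ≤ coverNum (ε / 2) F := Nat.cast_nonneg _
    linarith
  · have h1 : (coverNum δ F : ℝ) ≤ coverNum (ε / 2) F := by
      exact_mod_cast coverNum_anti (by positivity) (by linarith) hF
    have h2 : (0 : ℝ) ≤ coverNum (ε / 2) F := Nat.cast_nonneg _
    nlinarith

end BoxDimensions

/-! ### The upper bound -/

section UpperBound

open Bornology Metric

variable {n N : ℕ} {S : Fin N → (Space n ≃ᵃ[ℝ] Space n)} {C F : Set (Space n)}

/-- Iterating the defining equation of the attractor along words until these are stopped. -/
theorem attractor_subset (hn : 1 ≤ n) (hS : ∀ i, IsContracting (S i))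
    (hF : F = (⋃ i, S i '' F) ∪ C) {δ : ℝ} (hδ0 : 0 < δ) (hδ1 : δ ≤ 1) :
    F ⊆ (⋃ w ∈ {w | δ ≤ singVal n (wordMap S w)}, wordMap S w '' C) ∪
      ⋃ w ∈ stopping S n δ, wordMap S w '' F := by
  obtain ⟨c, hc0, hc1, hc⟩ := exists_contraction_ratio hS
  obtain ⟨L, _, hL, _⟩ := exists_length_bound hn hc0 hc1 hc hδ0
  intro x hx
  by_contra hcon
  rw [mem_union, not_or] at hcon
  simp only [mem_iUnion, not_exists] at hcon
  -- A point outside both unions could be followed to every depth with α_n ≥ δ, but such words have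
  -- bounded length.
  have key : ∀ k : ℕ, ∃ w : List (Fin N), w.length = k ∧ δ ≤ singVal n (wordMap S w) ∧
      x ∈ wordMap S w '' F := by
    intro k
    induction k with
    | zero => exact ⟨[], rfl, by rwa [wordMap_nil, singVal_one_eq_one hn], x, hx, rfl⟩
    | succ k ih =>
      obtain ⟨w, hw, hσ, y, hy, hyx⟩ := ih
      rw [hF] at hy
      rcases hy with hy | hy
      · obtain ⟨i, z, hz, rfl⟩ := mem_iUnion.1 hy
        have hmem : x ∈ wordMap S (w ++ [i]) '' F :=
          ⟨z, hz, by rw [wordMap_append, wordMap_singleton]; exact hyx⟩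
        refine ⟨w ++ [i], by simp [hw], ?_, hmem⟩
        by_contra! hlt
        exact hcon.2 (w ++ [i]) ⟨by simp, hlt, by rwa [List.dropLast_concat]⟩ hmem
      · exact absurd ⟨y, hy, hyx⟩ (hcon.1 w hσ)
  obtain ⟨w, hw, hσ, _⟩ := key L
  have := hL w hσ
  omega

/-- The powers combine exactly: (δ / α_n)^(-t) · |det| / α_n^n = δ^(-t) φ^t. -/
theorem coverNum_image_condensation_le (hn : 1 ≤ n) (hC : IsBounded C) {t K : ℝ}
    (ht1 : (n : ℝ) - 1 < t) (ht2 : t ≤ n)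
    (hK : ∀ δ : ℝ, 0 < δ → δ ≤ 1 → (coverNum δ C : ℝ) ≤ K * δ ^ (-t)) {δ : ℝ} (hδ : 0 < δ)
    (f : Space n ≃ᵃ[ℝ] Space n) (hf : δ ≤ singVal n f) :
    (coverNum δ (f '' C) : ℝ) ≤ K * (4 * (n + 1)) ^ n * δ ^ (-t) * phi t f := by
  have hp := singVal_pos f (m := n) (by omega)
  have h1 := coverNum_image_le_mul_coverNum hn f hδ hC
  have h2 := hK (δ / singVal n f) (by positivity) ((div_le_one hp).2 hf)
  have h3 : 0 ≤ absDet f * (4 * (n + 1) / singVal n f) ^ n :=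
    mul_nonneg (absDet_pos f).le (by positivity)
  refine (h1.trans (mul_le_mul_of_nonneg_right h2 h3)).trans_eq ?_
  rw [phi_of_mem_top_Ioc hn ht1 ht2, Real.div_rpow hδ.le hp.le, div_pow,
    show t - n = t + -(n : ℝ) by ring, Real.rpow_add hp, Real.rpow_neg hp.le (n : ℝ),
    Real.rpow_natCast, Real.rpow_neg hp.le t]
  have : singVal n f ^ t ≠ 0 := (Real.rpow_pos_of_pos hp _).ne'
  field_simp

/-- From α_n < δ and t ≤ n comes |det| ≤ δ^(n-t) φ^t, while α_n ≥ a δ keeps the enlargement of the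
ball bounded. -/
theorem coverNum_image_stopped_le (hn : 1 ≤ n) {t a R : ℝ} (ht1 : (n : ℝ) - 1 < t) (ht2 : t ≤ n)
    (ha : 0 < a) (hR : 0 ≤ R) {y : Space n} (hF : F ⊆ closedBall y R) {δ : ℝ} (hδ : 0 < δ)
    (f : Space n ≃ᵃ[ℝ] Space n) (hf : a * δ ≤ singVal n f) (hf' : singVal n f < δ) :
    (coverNum δ (f '' F) : ℝ) ≤ (4 * (R + 1 / (4 * a))) ^ n * δ ^ (-t) * phi t f := by
  have hp := singVal_pos f (m := n) (by omega)
  have h1 := coverNum_image_mul_le hn f hδ hR hF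
  have h2 : δ / 4 / singVal n f ≤ 1 / (4 * a) := by
    rw [div_div, div_le_div_iff₀ (by positivity) (by positivity)]
    linarith
  have h3 : absDet f * (R + δ / 4 / singVal n f) ^ n ≤ absDet f * (R + 1 / (4 * a)) ^ n :=
    mul_le_mul_of_nonneg_left (pow_le_pow_left₀ (by positivity) (by linarith) n) (absDet_pos f).le
  have h4 : absDet f ≤ δ ^ (-t) * phi t f * δ ^ n := by
    rw [phi_of_mem_top_Ioc hn ht1 ht2]
    have h5 : δ ^ (t - n) ≤ singVal n f ^ (t - n) :=
      Real.rpow_le_rpow_of_nonpos hp hf'.le (by linarith)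
    have h6 : δ ^ (-t) * δ ^ (t - n) * δ ^ n = 1 := by
      rw [← Real.rpow_natCast, ← Real.rpow_add hδ, ← Real.rpow_add hδ]
      ring_nf
      exact Real.rpow_zero δ
    calc absDet f = absDet f * (δ ^ (-t) * δ ^ (t - n) * δ ^ n) := by rw [h6, mul_one]
      _ ≤ absDet f * (δ ^ (-t) * singVal n f ^ (t - n) * δ ^ n) := by
          have := (absDet_pos f).le
          gcongr
      _ = _ := by ring
  refine le_of_mul_le_mul_right ((h1.trans h3).trans ?_) (show 0 < (δ / 4) ^ n by positivity)
  calc absDet f * (R + 1 / (4 * a)) ^ n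
      ≤ δ ^ (-t) * phi t f * δ ^ n * (R + 1 / (4 * a)) ^ n := by gcongr
    _ = _ := by
        rw [mul_pow, div_pow]
        field_simp

/-- The covering numbers of the attractor for an exponent at which the sum of the singular value
function over all words converges. -/
theorem exists_coverNum_attractor_le (hn : 1 ≤ n) (hS : ∀ i, IsContracting (S i))
    (hC : IsBounded C) (hFb : IsBounded F) (hF : F = (⋃ i, S i '' F) ∪ C) {t K : ℝ}
    (ht1 : (n : ℝ) - 1 < t) (ht2 : t ≤ n) (hsum : Summable (phiSum S t)) (hK0 : 0 < K)
    (hK : ∀ δ : ℝ, 0 < δ → δ ≤ 1 → (coverNum δ C : ℝ) ≤ K * δ ^ (-t)) :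
    ∃ K' : ℝ, 0 < K' ∧ ∀ δ : ℝ, 0 < δ → δ ≤ 1 → (coverNum δ F : ℝ) ≤ K' * δ ^ (-t) := by
  classical
  obtain ⟨a, ha0, _, ha⟩ := exists_le_singVal hn S
  obtain ⟨R, hR0, hR⟩ := hFb.subset_closedBall_lt 0 0
  set T := ∑' k, phiSum S t k with hT
  have hT0 : 0 ≤ T := tsum_nonneg fun k => phiSum_nonneg t k
  set K₁ := K * (4 * ((n : ℝ) + 1)) ^ n with hK₁
  set K₂ := (4 * (R + 1 / (4 * a))) ^ n with hK₂
  have hK₁0 : 0 < K₁ := by positivity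
  have hK₂0 : 0 < K₂ := by positivity
  refine ⟨(K₁ + K₂) * (T + 1), by positivity, fun δ hδ0 hδ1 => ?_⟩
  have hpow : 0 < δ ^ (-t) := Real.rpow_pos_of_pos hδ0 _
  have hfin₁ := finite_le_singVal hn hS hδ0
  have hfin₂ := finite_stopping hn hS hδ0
  have hb₁ : ∀ w : List (Fin N), IsBounded (wordMap S w '' C) := fun w => isBounded_image _ hC
  have hb₂ : ∀ w : List (Fin N), IsBounded (wordMap S w '' F) := fun w => isBounded_image _ hFb
  set J₁ := hfin₁.toFinset with hJ₁
  set J₂ := hfin₂.toFinset with hJ₂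
  -- Indexing the two families by `Bool` lets `coverNum_biUnion_le` serve for the binary union too.
  have hsub : F ⊆ ⋃ b ∈ (Finset.univ : Finset Bool),
      (if b then ⋃ w ∈ J₁, wordMap S w '' C else ⋃ w ∈ J₂, wordMap S w '' F) := by
    intro x hx
    rcases attractor_subset hn hS hF hδ0 hδ1 hx with h | h
    · refine mem_iUnion₂.2 ⟨true, Finset.mem_univ _, ?_⟩
      simpa [hJ₁] using h
    · refine mem_iUnion₂.2 ⟨false, Finset.mem_univ _, ?_⟩
      simpa [hJ₂] using h
  have hbB : ∀ b : Bool, IsBounded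
      (if b then ⋃ w ∈ J₁, wordMap S w '' C else ⋃ w ∈ J₂, wordMap S w '' F) := by
    intro b
    cases b
    · simpa using (isBounded_biUnion_finset J₂).2 fun w _ => hb₂ w
    · simpa using (isBounded_biUnion_finset J₁).2 fun w _ => hb₁ w
  have h1 := (coverNum_mono hδ0 ((isBounded_biUnion_finset _).2 fun b _ => hbB b) hsub).trans
    (coverNum_biUnion_le hδ0 _ fun b _ => hbB b)
  simp only [Fintype.sum_bool, if_true, Bool.false_eq_true, if_false] at h1
  have h2 := h1.trans (Nat.add_le_add (coverNum_biUnion_le hδ0 J₁ fun w _ => hb₁ w)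
    (coverNum_biUnion_le hδ0 J₂ fun w _ => hb₂ w))
  have h3 : (coverNum δ F : ℝ) ≤ ∑ w ∈ J₁, (coverNum δ (wordMap S w '' C) : ℝ) +
      ∑ w ∈ J₂, (coverNum δ (wordMap S w '' F) : ℝ) := by exact_mod_cast h2
  have h4 : ∑ w ∈ J₁, (coverNum δ (wordMap S w '' C) : ℝ) ≤ K₁ * δ ^ (-t) * T := by
    refine (Finset.sum_le_sum fun w hw => coverNum_image_condensation_le hn hC ht1 ht2 hK hδ0
      (wordMap S w) (by simpa [hJ₁] using hw)).trans ?_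
    rw [← Finset.mul_sum]
    exact mul_le_mul_of_nonneg_left (sum_phi_le_tsum hsum J₁) (by positivity)
  have h5 : ∑ w ∈ J₂, (coverNum δ (wordMap S w '' F) : ℝ) ≤ K₂ * δ ^ (-t) * T := by
    refine (Finset.sum_le_sum fun w hw => coverNum_image_stopped_le hn ht1 ht2 ha0 hR0.le hR hδ0
      (wordMap S w) (mul_le_singVal_of_mem_stopping hn ha0.le ha (by simpa [hJ₂] using hw))
      ((hfin₂.mem_toFinset.1 hw).2.1)).trans ?_
    rw [← Finset.mul_sum]
    exact mul_le_mul_of_nonneg_left (sum_phi_le_tsum hsum J₂) (by positivity)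
  have h6 : (0 : ℝ) ≤ (K₁ + K₂) * δ ^ (-t) := by positivity
  nlinarith

theorem upperBoxDim_le_natCast (hn : 1 ≤ n) (hFb : IsBounded F) (hne : F.Nonempty) :
    upperBoxDim F ≤ ((n : ℝ) : EReal) := by
  obtain ⟨R, hR0, hR⟩ := hFb.subset_closedBall_lt 0 0
  refine upperBoxDim_le_of_coverNum_le hFb hne (K := absDet (1 : Space n ≃ᵃ[ℝ] Space n) *
    (4 * (R + 1)) ^ n) (mul_pos (absDet_pos _) (by positivity)) fun δ hδ0 hδ1 => ?_
  have h1 := coverNum_image_mul_le hn (1 : Space n ≃ᵃ[ℝ] Space n) hδ0 hR0.le hR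
  rw [singVal_one_eq_one hn, div_one, AffineEquiv.coe_one, image_id] at h1
  refine le_of_mul_le_mul_right (h1.trans ?_) (show 0 < (δ / 4) ^ n by positivity)
  calc absDet (1 : Space n ≃ᵃ[ℝ] Space n) * (R + δ / 4) ^ n
      ≤ absDet (1 : Space n ≃ᵃ[ℝ] Space n) * (R + 1) ^ n :=
        mul_le_mul_of_nonneg_left (pow_le_pow_left₀ (by positivity) (by linarith) n)
          (absDet_pos _).le
    _ = _ := by
        rw [Real.rpow_neg hδ0.le, Real.rpow_natCast, mul_pow, div_pow]
        field_simp

end UpperBound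

/-! ### The lower bound -/

section LowerBound

open Bornology Metric MeasureTheory

variable {n N : ℕ} {S : Fin N → (Space n ≃ᵃ[ℝ] Space n)} {C F : Set (Space n)}

theorem image_condensation_subset (hF : F = (⋃ i, S i '' F) ∪ C) (w : List (Fin N)) :
    wordMap S w '' C ⊆ F := by
  have hC : C ⊆ F := by rw [hF]; exact subset_union_right
  have hS : ∀ i, S i '' F ⊆ F := fun i => by
    conv_rhs => rw [hF]
    exact (subset_iUnion (fun i => S i '' F) i).trans subset_union_left
  exact (image_mono hC).trans (image_wordMap_subset hS w)

/-- Under the open set condition the affinity dimension is at most the dimension of the space. -/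
theorem IsAffinityDimension.le_natCast (hn : 1 ≤ n) (hN : 1 ≤ N) (hS : ∀ i, IsContracting (S i))
    {U : Set (Space n)} (hU : IsOpen U) (hSU : ∀ i, S i '' U ⊆ U)
    (hd : ∀ i j, i ≠ j → Disjoint (S i '' U) (S j '' U)) {x₀ : Space n} {r : ℝ} (hr : 0 < r)
    (hX : ∀ i, S i '' closedBall x₀ r ⊆ closedBall x₀ r)
    (hne : (U ∩ closedBall x₀ r).Nonempty) {s : ℝ} (hs : IsAffinityDimension S s) : s ≤ n := by
  -- V has positive finite volume and contains its disjoint images, so the determinants sum to at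
  -- most 1, i.e. the sums of φ^n are at most 1.
  set V := U ∩ closedBall x₀ r with hV
  have hVm : MeasurableSet V := hU.measurableSet.inter measurableSet_closedBall
  have hVfin : volume V ≠ ⊤ :=
    ((measure_mono inter_subset_right).trans_lt measure_closedBall_lt_top).ne
  have hVpos : 0 < volume.real V := by
    refine ENNReal.toReal_pos (ne_of_gt ?_) hVfin
    have hne' : (U ∩ ball x₀ r).Nonempty := by
      obtain ⟨x, hxU, hxr⟩ := hne
      rw [← closure_ball x₀ hr.ne'] at hxr
      exact mem_closure_iff.1 hxr U hU hxU
    exact ((hU.inter isOpen_ball).measure_pos volume hne').trans_le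
      (measure_mono (inter_subset_inter_right _ ball_subset_closedBall))
  have hsum : ∑ i, absDet (S i) ≤ 1 := by
    have h1 : volume.real (⋃ i ∈ (Finset.univ : Finset (Fin N)), S i '' V) =
        ∑ i, volume.real (S i '' V) := by
      refine measureReal_biUnion_finset (fun i _ j _ hij => (hd i j hij).mono
        (image_mono inter_subset_left) (image_mono inter_subset_left)) (fun i _ => ?_) fun i _ => ?_
      · have h := (AffineEquiv.toContinuousAffineEquiv (S i)).toHomeomorph.measurableEmbedding
        exact h.measurableSet_image.2 hVm
      · exact (isBounded_image (S i) (isBounded_closedBall.subset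
          inter_subset_right)).measure_lt_top.ne
    have h2 : (⋃ i ∈ (Finset.univ : Finset (Fin N)), S i '' V) ⊆ V :=
      iUnion₂_subset fun i _ => subset_inter ((image_mono inter_subset_left).trans (hSU i))
        ((image_mono inter_subset_right).trans (hX i))
    have h3 := measureReal_mono h2 hVfin
    rw [h1, Finset.sum_congr rfl fun i _ => volume_real_image (S i) V, ← Finset.sum_mul] at h3
    exact le_of_mul_le_mul_right (by rwa [one_mul]) hVpos
  have hphi : ∀ f : Space n ≃ᵃ[ℝ] Space n, phi n f = absDet f := fun f => by
    rw [phi_of_mem_top_Ioc hn (by linarith) le_rfl, sub_self, Real.rpow_zero, mul_one]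
  have hone : phiSum S n 1 ≤ 1 := by
    rw [phiSum_eq, ← Equiv.sum_comp (Equiv.funUnique (Fin 1) (Fin N)).symm]
    refine (Finset.sum_congr rfl fun i _ => ?_).trans_le hsum
    rw [hphi]
    simp [wordMap]
  have hall : ∀ k : ℕ, 1 ≤ k → phiSum S n k ≤ 1 := by
    intro k hk
    induction k, hk using Nat.le_induction with
    | base => exact hone
    | succ k _ ih =>
      exact (phiSum_add_le _ _ _).trans (mul_le_one₀ ih (phiSum_nonneg _ _) hone)
  by_contra! hlt
  obtain ⟨k, h1, h2⟩ := ((hs.eventually_one_lt_phiSum hn hN hS (Nat.cast_nonneg n) hlt).and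
    (eventually_ge_atTop 1)).exists
  linarith [hall k h2]

/-- A cube of sidelength `δ` meets boundedly many of the stopped copies of the condensation
set. -/
theorem card_filter_inter_nonempty_le (hn : 1 ≤ n) (hS : ∀ i, IsContracting (S i))
    {U : Set (Space n)} (hSU : ∀ i, S i '' U ⊆ U)
    (hd : ∀ i j, i ≠ j → Disjoint (S i '' U) (S j '' U)) {ρ a : ℝ} (hρ : 0 < ρ)
    (hCU : ∀ x ∈ C, ball x ρ ⊆ U) (ha0 : 0 < a) (ha : ∀ i, a ≤ singVal n (S i)) {δ : ℝ}
    (hδ : 0 < δ) {J : Finset (List (Fin N))} (hJ : ∀ w ∈ J, w ∈ stopping S n δ) (y : Space n)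
    (hy : ∀ w ∈ J, (cube y δ ∩ wordMap S w '' C).Nonempty) :
    (J.card : ℝ) ≤ ((n + ρ * a) / (ρ * a)) ^ n := by
  choose! z hz using hy
  -- A stopped map has α_n ≥ a δ, so it sends a ρ-ball around a point of C onto a set containing an
  -- r-ball. These balls are disjoint and lie near the cube.
  set r := ρ * a * δ with hr
  have hr0 : 0 < r := by positivity
  have hsub : ∀ w ∈ J, ball (z w) r ⊆ wordMap S w '' U := by
    intro w hw
    obtain ⟨x, hx, hxz⟩ := (hz w hw).2
    have hp := singVal_pos (wordMap S w) (m := n) (by omega)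
    rw [← hxz]
    refine (ball_subset_image_ball hn _ x r).trans (image_mono ?_)
    refine (ball_subset_ball ?_).trans (hCU x hx)
    rw [div_le_iff₀ hp, hr, mul_assoc]
    exact mul_le_mul_of_nonneg_left (mul_le_singVal_of_mem_stopping hn ha0.le ha (hJ w hw)) hρ.le
  have h := card_mul_le_of_pairwiseDisjoint_ball J z hr0 (fun v hv w hw hvw => by
    refine (disjoint_image_wordMap hSU hd v w ?_ ?_).mono (hsub v hv) (hsub w hw)
    · exact fun h => hvw (eq_of_prefix_of_mem_stopping hn hS (hJ v hv) (hJ w hw) h)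
    · exact fun h => hvw (eq_of_prefix_of_mem_stopping hn hS (hJ w hw) (hJ v hv) h).symm)
    (V := closedBall y (n * δ + r)) measure_closedBall_lt_top.ne (fun w hw => by
      have := cube_subset_closedBall y hδ.le (hz w hw).1
      rw [mem_closedBall] at this
      exact ball_subset_closedBall.trans (closedBall_subset_closedBall' (by linarith)))
  rw [volume_real_closedBall _ (by positivity), ← mul_assoc] at h
  have h2 := le_of_mul_le_mul_right h (ballVol_pos n)
  rw [← le_div_iff₀ (by positivity), ← div_pow] at h2
  refine h2.trans_eq ?_
  rw [hr]
  congr 1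
  field_simp

/-- The stopped copies of the condensation set contribute essentially independently to the
covering number of the attractor. -/
theorem sum_coverNum_stopping_le (hn : 1 ≤ n) (hS : ∀ i, IsContracting (S i))
    {U : Set (Space n)} (hSU : ∀ i, S i '' U ⊆ U)
    (hd : ∀ i j, i ≠ j → Disjoint (S i '' U) (S j '' U)) {ρ a : ℝ} (hρ : 0 < ρ)
    (hCU : ∀ x ∈ C, ball x ρ ⊆ U) (ha0 : 0 < a) (ha : ∀ i, a ≤ singVal n (S i))
    (hFb : IsBounded F) (hF : F = (⋃ i, S i '' F) ∪ C) {δ : ℝ}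
    (hδ : 0 < δ) {I : Finset (List (Fin N))} (hI : ∀ w ∈ I, w ∈ stopping S n δ) :
    ∑ w ∈ I, (coverNum δ (wordMap S w '' C) : ℝ) ≤
      ((n + ρ * a) / (ρ * a)) ^ n * coverNum δ F := by
  classical
  obtain ⟨t, ht, hcov⟩ := exists_cover_card_eq hδ hFb
  -- The cubes of an optimal cover of F that meet a copy of C also cover that copy; then incidences
  -- are counted in both orders.
  have h1 : ∀ w ∈ I, coverNum δ (wordMap S w '' C) ≤
      (t.filter fun y => (cube y δ ∩ wordMap S w '' C).Nonempty).card := by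
    intro w _
    refine coverNum_le_card fun x hx => ?_
    obtain ⟨y, hy, hxy⟩ := mem_iUnion₂.1 (hcov (image_condensation_subset hF w hx))
    exact mem_iUnion₂.2 ⟨y, Finset.mem_filter.2 ⟨hy, x, hxy, hx⟩, hxy⟩
  have h2 : ∑ w ∈ I, (t.filter fun y => (cube y δ ∩ wordMap S w '' C).Nonempty).card =
      ∑ y ∈ t, (I.filter fun w => (cube y δ ∩ wordMap S w '' C).Nonempty).card :=
    Finset.sum_card_bipartiteAbove_eq_sum_card_bipartiteBelow _
  calc ∑ w ∈ I, (coverNum δ (wordMap S w '' C) : ℝ)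
      ≤ ∑ y ∈ t, ((I.filter fun w => (cube y δ ∩ wordMap S w '' C).Nonempty).card : ℝ) := by
        exact_mod_cast (Finset.sum_le_sum h1).trans_eq h2
    _ ≤ ∑ _y ∈ t, ((n + ρ * a) / (ρ * a)) ^ n := by
        refine Finset.sum_le_sum fun y _ => ?_
        exact card_filter_inter_nonempty_le hn hS hSU hd hρ hCU ha0 ha hδ
          (fun w hw => hI w (Finset.mem_filter.1 hw).1) y fun w hw => (Finset.mem_filter.1 hw).2
    _ = _ := by rw [Finset.sum_const, nsmul_eq_mul, ht, mul_comm]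

/-- Volume forces about |det| δ^(-n) cubes, and α_n ≥ a δ with t ≤ n gives φ^t ≤ |det| (a δ)^(t-n).
-/
theorem phi_le_coverNum_image_closedBall (hn : 1 ≤ n) {t a r : ℝ} (ht1 : (n : ℝ) - 1 < t)
    (ht2 : t ≤ n) (ha : 0 < a) (hr : 0 < r) (y : Space n) {δ : ℝ} (hδ : 0 < δ)
    (f : Space n ≃ᵃ[ℝ] Space n) (hf : a * δ ≤ singVal n f) :
    (r / n) ^ n * a ^ (n - t) * δ ^ (-t) * phi t f ≤ coverNum δ (f '' closedBall y r) := by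
  have hn' : (0 : ℝ) < n := by exact_mod_cast hn
  have h1 := volume_le_coverNum_mul hδ (isBounded_image f (isBounded_closedBall (x := y) (r := r)))
  rw [volume_real_image, volume_real_closedBall _ hr.le, ← mul_assoc, ← mul_assoc] at h1
  have h2 := le_of_mul_le_mul_right h1 (ballVol_pos n)
  have h3 : singVal n f ^ (t - n) ≤ (a * δ) ^ (t - n) :=
    Real.rpow_le_rpow_of_nonpos (by positivity) hf (by linarith)
  have h4 : a ^ (n - t) * δ ^ (-t) * (a * δ) ^ (t - n) * δ ^ n = 1 := by
    rw [Real.mul_rpow ha.le hδ.le]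
    have e1 : a ^ ((n : ℝ) - t) * a ^ (t - n) = 1 := by
      rw [← Real.rpow_add ha, sub_add_sub_cancel, sub_self, Real.rpow_zero]
    have e2 : δ ^ (-t) * δ ^ (t - n) * δ ^ n = 1 := by
      rw [← Real.rpow_natCast, ← Real.rpow_add hδ, ← Real.rpow_add hδ,
        show -t + (t - n) + n = 0 by ring, Real.rpow_zero]
    calc _ = (a ^ ((n : ℝ) - t) * a ^ (t - n)) * (δ ^ (-t) * δ ^ (t - n) * δ ^ n) := by ring
      _ = 1 := by rw [e1, e2, mul_one]
  refine le_of_mul_le_mul_right ?_ (show 0 < (n * δ) ^ n by positivity)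
  refine le_trans ?_ h2
  rw [phi_of_mem_top_Ioc hn ht1 ht2]
  have hA := (absDet_pos f).le
  calc (r / n) ^ n * a ^ (n - t) * δ ^ (-t) * (absDet f * singVal n f ^ (t - n)) * (n * δ) ^ n
      ≤ (r / n) ^ n * a ^ (n - t) * δ ^ (-t) * (absDet f * (a * δ) ^ (t - n)) * (n * δ) ^ n := by
        gcongr
    _ = absDet f * (r / n) ^ n * n ^ n *
        (a ^ (n - t) * δ ^ (-t) * (a * δ) ^ (t - n) * δ ^ n) := by rw [mul_pow]; ring
    _ = absDet f * r ^ n := by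
        rw [h4, mul_one, mul_assoc, ← mul_pow, div_mul_cancel₀ _ hn'.ne']

/-- Exponents above `n - 1` and below the affinity dimension bound the lower box dimension of the
attractor from below. -/
theorem le_lowerBoxDim_attractor (hn : 1 ≤ n) (hS : ∀ i, IsContracting (S i))
    {U : Set (Space n)} (hU : IsOpen U) (hSU : ∀ i, S i '' U ⊆ U)
    (hd : ∀ i j, i ≠ j → Disjoint (S i '' U) (S j '' U)) (hC : IsCompact C) (hCU : C ⊆ U)
    {x₀ : Space n} {r κ : ℝ} (hr : 0 < r) (hκ0 : 0 < κ)
    (hκ : ∀ δ : ℝ, 0 < δ → δ ≤ 1 → ∀ w ∈ stopping S n δ,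
      κ * (coverNum δ (wordMap S w '' closedBall x₀ r) : ℝ) ≤ coverNum δ (wordMap S w '' C))
    (hFb : IsBounded F) (hF : F = (⋃ i, S i '' F) ∪ C) {t : ℝ} (ht1 : (n : ℝ) - 1 < t)
    (ht2 : t ≤ n) (ht : ∀ᶠ k in atTop, 1 < phiSum S t k) : (t : EReal) ≤ lowerBoxDim F := by
  have hn' : (0 : ℝ) < n := by exact_mod_cast hn
  obtain ⟨a, ha0, _, ha⟩ := exists_le_singVal hn S
  -- Compactness makes the distance from C to the complement of U uniform.
  obtain ⟨ρ, hρ, hρU⟩ := hC.exists_thickening_subset_open hU hCU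
  have hball : ∀ x ∈ C, ball x ρ ⊆ U := fun x hx => (ball_subset_thickening hx ρ).trans hρU
  set M := (((n : ℝ) + ρ * a) / (ρ * a)) ^ n with hM
  have hM0 : 0 < M := by positivity
  set D := (r / n) ^ n * a ^ ((n : ℝ) - t) with hD
  have hD0 : 0 < D := by positivity
  refine le_lowerBoxDim_of_le_coverNum (K := κ * D / M) (by positivity) fun δ hδ0 hδ1 => ?_
  have hfin := finite_stopping hn hS hδ0
  set I := hfin.toFinset with hI
  have hmem : ∀ w, w ∈ I ↔ w ∈ stopping S n δ := fun w => hfin.mem_toFinset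
  have h1 := one_le_sum_stopping hn hS ht hδ0 hδ1 hmem
  have h2 := sum_coverNum_stopping_le hn hS hSU hd hρ hball ha0 ha hFb hF hδ0
    fun w hw => (hmem w).1 hw
  have hpow : 0 < δ ^ (-t) := Real.rpow_pos_of_pos hδ0 _
  have h3 : κ * (D * δ ^ (-t)) ≤ ∑ w ∈ I, (coverNum δ (wordMap S w '' C) : ℝ) := by
    calc κ * (D * δ ^ (-t)) ≤ κ * (D * δ ^ (-t)) * ∑ w ∈ I, phi t (wordMap S w) :=
          le_mul_of_one_le_right (by positivity) h1
      _ = ∑ w ∈ I, κ * (D * δ ^ (-t) * phi t (wordMap S w)) := by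
          rw [Finset.mul_sum]
          exact Finset.sum_congr rfl fun w _ => by ring
      _ ≤ _ := by
          refine Finset.sum_le_sum fun w hw => ?_
          have hw' := (hmem w).1 hw
          refine le_trans (mul_le_mul_of_nonneg_left ?_ hκ0.le) (hκ δ hδ0 hδ1 w hw')
          exact phi_le_coverNum_image_closedBall hn ht1 ht2 ha0 hr x₀ hδ0 _
            (mul_le_singVal_of_mem_stopping hn ha0.le ha hw')
  rw [div_mul_eq_mul_div, div_le_iff₀ hM0]
  linarith

end LowerBound

end AffineIFS

end

/-! ### The dimension formulas -/

theorem theorem2p3 {n N : ℕ} (hn : 1 ≤ n) (hN : 1 ≤ N)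
    -- an affine iterated function system on `ℝⁿ`
    (S : Fin N → (AffineIFS.Space n ≃ᵃ[ℝ] AffineIFS.Space n))
    (hS : ∀ i, AffineIFS.IsContracting (S i))
    -- the condensation set
    (C : Set (AffineIFS.Space n)) (hC : IsCompact C) (hCne : C.Nonempty)
    (hCOSC : AffineIFS.CondensationOSC S C)
    -- a compact ball that is mapped into itself and contains the condensation set
    (x₀ : AffineIFS.Space n) (r : ℝ) (hr : 0 < r)
    (hX : ∀ i, S i '' Metric.closedBall x₀ r ⊆ Metric.closedBall x₀ r)
    (hCX : C ⊆ Metric.closedBall x₀ r)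
    (hdim : (((n : ℝ) - 1 : ℝ) : EReal) ≤ AffineIFS.lowerBoxDim C)
    (hκ : ∃ κ : ℝ, 0 < κ ∧ ∀ δ : ℝ, 0 < δ → δ ≤ 1 → ∀ w ∈ AffineIFS.stopping S n δ,
      κ * (AffineIFS.coverNum δ (AffineIFS.wordMap S w '' Metric.closedBall x₀ r) : ℝ) ≤
        (AffineIFS.coverNum δ (AffineIFS.wordMap S w '' C) : ℝ))
    -- the inhomogeneous attractor
    (F : Set (AffineIFS.Space n)) (hF : AffineIFS.IsInhomogeneousAttractor S C F) :
    (∃ s : ℝ, AffineIFS.IsAffinityDimension S s) ∧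
    ∀ s : ℝ, AffineIFS.IsAffinityDimension S s →
      AffineIFS.upperBoxDim F = max (s : EReal) (AffineIFS.upperBoxDim C) ∧
      max (s : EReal) (AffineIFS.lowerBoxDim C) ≤ AffineIFS.lowerBoxDim F ∧
      AffineIFS.lowerBoxDim F ≤ max (s : EReal) (AffineIFS.upperBoxDim C) := by
  obtain ⟨U, hU, hCU', hSU, hd⟩ := hCOSC
  obtain ⟨κ, hκ0, hκ⟩ := hκ
  obtain ⟨hFne, hFc, hFeq⟩ := hF
  have hCU : C ⊆ U := fun x hx => (hCU' hx).1
  have hFb := hFc.isBounded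
  have hCF : C ⊆ F := by rw [hFeq]; exact subset_union_right
  refine ⟨AffineIFS.exists_isAffinityDimension hn hN hS, fun s hs => ?_⟩
  have hn1 : (0 : ℝ) ≤ n - 1 := by
    have : (1 : ℝ) ≤ n := by exact_mod_cast hn
    linarith
  have hup : AffineIFS.upperBoxDim F ≤ max (s : EReal) (AffineIFS.upperBoxDim C) := by
    by_contra! hlt
    obtain ⟨t, ht1, ht2⟩ := EReal.lt_iff_exists_real_btwn.1 hlt
    obtain ⟨hst, hCt⟩ := max_lt_iff.1 ht1
    rcases le_or_gt t n with htn | htn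
    · have hnt : (n : ℝ) - 1 < t := EReal.coe_lt_coe_iff.1
        ((hdim.trans (AffineIFS.lowerBoxDim_le_upperBoxDim C)).trans_lt hCt)
      obtain ⟨K, hK0, hK⟩ := AffineIFS.exists_coverNum_le_of_upperBoxDim_lt hC.isBounded
        (hn1.trans hnt.le) hCt
      obtain ⟨K', hK'0, hK'⟩ := AffineIFS.exists_coverNum_attractor_le hn hS hC.isBounded hFb hFeq
        hnt htn (hs.summable_phiSum hn hN hS (EReal.coe_lt_coe_iff.1 hst)) hK0 hK
      exact absurd (AffineIFS.upperBoxDim_le_of_coverNum_le hFb hFne hK'0 hK') (not_le.2 ht2)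
    · exact absurd ((EReal.coe_lt_coe_iff.2 htn).trans ht2)
        (not_lt.2 (AffineIFS.upperBoxDim_le_natCast hn hFb hFne))
  have hCl := AffineIFS.lowerBoxDim_mono hFb hCne hCF
  have hsl : (s : EReal) ≤ AffineIFS.lowerBoxDim F := by
    by_contra! hlt
    -- F inherits lower dimension at least n - 1 from C, so any exponent between the lower dimension
    -- of F and s exceeds n - 1.
    have hns : (((n : ℝ) - 1 : ℝ) : EReal) < s := (hdim.trans hCl).trans_lt hlt
    obtain ⟨t, ht1, ht2⟩ := EReal.lt_iff_exists_real_btwn.1 hlt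
    have hnt : (n : ℝ) - 1 < t := EReal.coe_lt_coe_iff.1 ((hdim.trans hCl).trans_lt ht1)
    have hts : t < s := EReal.coe_lt_coe_iff.1 ht2
    have hsn : s ≤ n := hs.le_natCast hn hN hS hU hSU hd hr hX
      (hCne.mono (subset_inter hCU hCX))
    have := AffineIFS.le_lowerBoxDim_attractor hn hS hU hSU hd hC hCU hr hκ0 hκ hFb hFeq hnt
      (hts.le.trans hsn) (hs.eventually_one_lt_phiSum hn hN hS (hn1.trans hnt.le) hts)
    exact absurd this (not_le.2 ht1)
  have hlu := AffineIFS.lowerBoxDim_le_upperBoxDim F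
  exact ⟨le_antisymm hup (max_le (hsl.trans hlu) (AffineIFS.upperBoxDim_mono hFb hCne hCF)),
    max_le hsl hCl, hlu.trans hup⟩
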